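/- Let $k$ be a field of characteristic $0$. A \emph{variety} is an irreducible scheme of finite type over $k$ (not necessarily reduced), and locally free modules have finite rank. For a variety $X$ and a locally free $\mathcal O_X$-module $M$ let $\mathcal P^n_{X/k}(M)=\mathcal P^n_{X/k}\otimes_{\mathcal O_X} M$ be the sheaf of principal parts of order $n\ge 0$, where $\mathcal P^n_{X/k}=\Delta^{-1}(\mathcal O_{X\times_k X})/I_\Delta^{n+1}$, and let $\mathcal D^n_X(M)=\mathcal Hom_{\mathcal O_X}(\mathcal P^n_{X/k}(M),M)$ be the sheaf of differential operators of order at most $n$; it acts on $M$ by $P\cdot m=P(1\otimes m)$. If $V$ is a finite-dimensional $k$-vector space with an injective linear map $i:V\to\Gamma(X,M)$, let $\Gamma(X,\mathcal D^{n,V}_X(M))$ be the space of those $P\in\Gamma(X,\mathcal D^n_X(M))$ with $P\cdot i(V)\subseteq i(V)$, and let the Taylor map be $d^n_V:\mathcal O_X\otimes_k V\to\mathcal P^n_{X/k}(M)$, $\phi\otimes v\mapsto\phi\otimes i(v)$, with cokernel $\mathcal C^n_X$. Let $A=(X,M,i:V\to\Gamma(X,M))$ and $B=(\bar X,\bar M,\bar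 i:\bar V\to\Gamma(\bar X,\bar M))$ be two such data, and let $A\to B$ be a full completion: $\bar X$ is projective over $k$, and one is given an open immersion $j:X\to\bar X$ over $k$, an isomorphism $\psi:j^*\bar M\cong M$ and a linear isomorphism $F:\bar V\cong V$ induced by restriction of sections along $j$ and $\psi$, and $\bar i:\bar V\to\Gamma(\bar X,\bar M)$ is an isomorphism. Assume that $\bar X$ has no embedded points, that is, it satisfies Serre's condition $S_1$ (for instance, $\bar X$ is integral). Let $n\ge0$. \begin{enumerate} \item Restriction of differential operators along $j$ and $\psi$ takes $\Gamma(\bar X,\mathcal D^n_{\bar X}(\bar M))$ into $\Gamma(X,\mathcal D^{n,V}_X(M))$, and the resulting $k$-linear map $$r_{\bar X,X}:\Gamma(\bar X,\mathcal D^n_{\bar X}(\bar M))\to\Gamma(X,\mathcal D^{n,V}_X(M))$$ is injective. \item If $\bar X$ satisfies Serre's condition $S_2$ (for instance, $\bar X$ is normal) and the support of the cokernel $\mathcal C^n_{\bar X}$ of the Taylor map $d^n_{\bar V}:\mathcal O_{\bar X}\otimes_k\bar V\to\mathcal P^n_{\bar X/k}(\bar M)$ has codimension at least $2$ in $\bar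 X$ (the empty set has codimension $\infty$), then $r_{\bar X,X}$ is an isomorphism. \item If $\bar M$ is a very ample line bundle on $\bar X$ over $k$ and $n=1$, then $r_{\bar X,X}$ is an isomorphism. \end{enumerate} Here $S_r$ means that $\operatorname{depth}\mathcal O_{\bar X,x}\ge\min(r,\dim\mathcal O_{\bar X,x})$ for all $x\in\bar X$. -/

import Mathlib

open CategoryTheory Opposite AlgebraicGeometry TopologicalSpace
open scoped TensorProduct

universe u

noncomputable section

namespace DiffOps

section Algebra

variable (k : Type u) [CommRing k] (A : Type u) [CommRing A] [Algebra k A]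
  (M : Type u) [AddCommGroup M] [Module k M] [Module A M] [IsScalarTower k A M]

/-- The action `t ↦ t • (1 ⊗ m)` of `A ⊗ₖ A` on the element `1 ⊗ m` of `A ⊗ₖ M`,
that is `a ⊗ b ↦ a ⊗ b m`. -/
def tensorAct (m : M) : A ⊗[k] A →ₗ[A] A ⊗[k] M :=
  TensorProduct.AlgebraTensorModule.map LinearMap.id
    ((LinearMap.toSpanSingleton A M m).restrictScalars k)

/-- `I ^ (n + 1) • (A ⊗ₖ M)`, where `I` is the kernel of the multiplication
`A ⊗ₖ A → A`: it is spanned by the elements `t • (1 ⊗ m)` with `t ∈ I ^ (n + 1)`. -/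
def diagonalPower (n : ℕ) : Submodule A (A ⊗[k] M) :=
  Submodule.span A {z | ∃ t ∈ KaehlerDifferential.ideal k A ^ (n + 1), ∃ m : M,
    z = tensorAct k A M m t}

/-- The module of principal parts of order `n`,
`Pⁿ(M) = (A ⊗ₖ A / I ^ (n + 1)) ⊗_A M = (A ⊗ₖ M) / I ^ (n + 1) (A ⊗ₖ M)`, with the
`A`-module structure coming from the left factor. -/
abbrev PrincipalParts (n : ℕ) : Type u := (A ⊗[k] M) ⧸ diagonalPower k A M n

variable {A M}
variable {B : Type u} [CommRing B] [Algebra k B]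
  {N : Type u} [AddCommGroup N] [Module k N] [Module B N] [IsScalarTower k B N]

/-- The `k`-linear map underlying a semilinear map. -/
def semilinearRestrict (σ : A →ₐ[k] B) (f : M →+ N) (hf : ∀ a m, f (a • m) = σ a • f m) :
    M →ₗ[k] N where
  toFun := f
  map_add' := f.map_add
  map_smul' c m := by
    rw [← algebraMap_smul A c m, hf, σ.commutes, algebraMap_smul, RingHom.id_apply]

/-- The map `A ⊗ₖ M → B ⊗ₖ N` induced by `σ : A → B` and a `σ`-semilinear `f : M → N`. -/
def tensorMap (σ : A →ₐ[k] B) (f : M →+ N) (hf : ∀ a m, f (a • m) = σ a • f m) :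
    A ⊗[k] M →ₛₗ[(σ : A →+* B)] B ⊗[k] N where
  toFun := TensorProduct.map σ.toLinearMap (semilinearRestrict k σ f hf)
  map_add' := map_add _
  map_smul' a z := by
    induction z with
    | zero => simp
    | add x y hx hy => simp only [smul_add, map_add, hx, hy]
    | tmul b m => simp [TensorProduct.smul_tmul']

theorem tensorMap_tmul (σ : A →ₐ[k] B) (f : M →+ N) (hf : ∀ a m, f (a • m) = σ a • f m)
    (a : A) (m : M) : tensorMap k σ f hf (a ⊗ₜ m) = σ a ⊗ₜ f m := rfl

theorem tensorMap_tensorAct (σ : A →ₐ[k] B) (f : M →+ N)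
    (hf : ∀ a m, f (a • m) = σ a • f m) (m : M) (t : A ⊗[k] A) :
    tensorMap k σ f hf (tensorAct k A M m t) =
      tensorAct k B N (f m) (Algebra.TensorProduct.map σ σ t) := by
  induction t with
  | zero => simp
  | add x y hx hy => simp only [map_add, hx, hy]
  | tmul b a => simp [tensorAct, tensorMap_tmul, hf]

theorem map_mem_ideal (σ : A →ₐ[k] B) (t : A ⊗[k] A)
    (ht : t ∈ KaehlerDifferential.ideal k A) :
    Algebra.TensorProduct.map σ σ t ∈ KaehlerDifferential.ideal k B := by
  have h : ∀ t : A ⊗[k] A, Algebra.TensorProduct.lmul' k (S := B)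
      (Algebra.TensorProduct.map σ σ t) = σ (Algebra.TensorProduct.lmul' k (S := A) t) := by
    intro t
    induction t with
    | zero => simp
    | add x y hx hy => simp only [map_add, hx, hy]
    | tmul b a => simp
  have h0 : Algebra.TensorProduct.lmul' k (S := A) t = 0 := ht
  change Algebra.TensorProduct.lmul' k (S := B) _ = 0
  rw [h, h0, map_zero]

theorem diagonalPower_le (n : ℕ) (σ : A →ₐ[k] B) (f : M →+ N)
    (hf : ∀ a m, f (a • m) = σ a • f m) :
    diagonalPower k A M n ≤ (diagonalPower k B N n).comap (tensorMap k σ f hf) := by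
  refine Submodule.span_le.2 ?_
  rintro z ⟨t, ht, m, rfl⟩
  refine Submodule.subset_span ⟨_, ?_, f m, tensorMap_tensorAct k σ f hf m t⟩
  have h1 : (KaehlerDifferential.ideal k A).map
      (Algebra.TensorProduct.map σ σ : A ⊗[k] A →ₐ[k] B ⊗[k] B) ≤
      KaehlerDifferential.ideal k B :=
    Ideal.map_le_iff_le_comap.2 fun t ht => map_mem_ideal k σ t ht
  have h2 := Ideal.mem_map_of_mem
    (Algebra.TensorProduct.map σ σ : A ⊗[k] A →ₐ[k] B ⊗[k] B) ht
  rw [Ideal.map_pow] at h2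
  exact Ideal.pow_right_mono h1 _ h2

/-- Functoriality of principal parts: `[a ⊗ m] ↦ [σ a ⊗ f m]`. -/
def principalPartsMap (n : ℕ) (σ : A →ₐ[k] B) (f : M →+ N)
    (hf : ∀ a m, f (a • m) = σ a • f m) :
    PrincipalParts k A M n →ₛₗ[(σ : A →+* B)] PrincipalParts k B N n :=
  Submodule.mapQ _ _ (tensorMap k σ f hf) (diagonalPower_le k n σ f hf)

theorem principalPartsMap_mk (n : ℕ) (σ : A →ₐ[k] B) (f : M →+ N)
    (hf : ∀ a m, f (a • m) = σ a • f m) (a : A) (m : M) :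
    principalPartsMap k n σ f hf (Submodule.Quotient.mk (a ⊗ₜ m)) =
      Submodule.Quotient.mk (σ a ⊗ₜ f m) := rfl

theorem principalParts_induction (n : ℕ) {p : PrincipalParts k A M n → Prop}
    (hadd : ∀ x y, p x → p y → p (x + y))
    (hmk : ∀ (a : A) (m : M), p (Submodule.Quotient.mk (a ⊗ₜ m))) (x) : p x := by
  obtain ⟨z, rfl⟩ := Submodule.Quotient.mk_surjective _ x
  induction z with
  | zero => simpa using hmk 0 0
  | add x y hx hy => exact hadd _ _ hx hy
  | tmul a m => exact hmk a m

theorem principalPartsMap_id (n : ℕ) (σ : A →ₐ[k] A) (f : M →+ M)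
    (hf : ∀ a m, f (a • m) = σ a • f m) (h1 : ∀ a, σ a = a) (h2 : ∀ m, f m = m)
    (x : PrincipalParts k A M n) : principalPartsMap k n σ f hf x = x := by
  induction x using principalParts_induction with
  | hadd x y hx hy => rw [map_add, hx, hy]
  | hmk a m => rw [principalPartsMap_mk, h1, h2]

theorem principalPartsMap_comp {C : Type u} [CommRing C] [Algebra k C]
    {L : Type u} [AddCommGroup L] [Module k L] [Module C L] [IsScalarTower k C L] (n : ℕ)
    (σ : A →ₐ[k] B) (f : M →+ N) (hf : ∀ a m, f (a • m) = σ a • f m)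
    (τ : B →ₐ[k] C) (g : N →+ L) (hg : ∀ a m, g (a • m) = τ a • g m)
    (ρ : A →ₐ[k] C) (h : M →+ L) (hh : ∀ a m, h (a • m) = ρ a • h m)
    (h1 : ∀ a, ρ a = τ (σ a)) (h2 : ∀ m, h m = g (f m)) (x : PrincipalParts k A M n) :
    principalPartsMap k n ρ h hh x =
      principalPartsMap k n τ g hg (principalPartsMap k n σ f hf x) := by
  induction x using principalParts_induction with
  | hadd x y hx hy => rw [map_add, hx, hy, map_add, map_add]
  | hmk a m => rw [principalPartsMap_mk, principalPartsMap_mk, principalPartsMap_mk, h1, h2]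

end Algebra

section Scheme

variable (k : Type u) [Field k] (X : Scheme.{u}) [X.Over (Spec (CommRingCat.of k))]

/-- The ring homomorphism `k → Γ(X, U)` of a scheme over `Spec k`. -/
def scalars (U : X.Opens) : k →+* Γ(X, U) :=
  (X.presheaf.map (homOfLE le_top : U ⟶ ⊤).op).hom.comp
    ((X ↘ Spec (CommRingCat.of k)).appTop.hom.comp
      (Scheme.ΓSpecIso (CommRingCat.of k)).inv.hom)

instance sectionsAlgebra (U : X.Opens) : Algebra k Γ(X, U) := (scalars k X U).toAlgebra

variable {X}

instance sectionsModule (M : X.Modules) (U : X.Opens) : Module k Γ(M, U) :=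
  Module.compHom _ (algebraMap k Γ(X, U))

instance sectionsTower (M : X.Modules) (U : X.Opens) : IsScalarTower k Γ(X, U) Γ(M, U) :=
  IsScalarTower.of_algebraMap_smul fun _ _ => rfl

theorem map_scalars {U V : X.Opens} (i : U ⟶ V) (c : k) :
    X.presheaf.map i.op (algebraMap k Γ(X, V) c) = algebraMap k Γ(X, U) c := by
  change (X.presheaf.map _ ≫ X.presheaf.map i.op) _ = X.presheaf.map _ _
  rw [← Functor.map_comp]
  rfl

/-- Restriction of functions, as a homomorphism of `k`-algebras. -/
def resAlg {U V : X.Opens} (i : U ⟶ V) : Γ(X, V) →ₐ[k] Γ(X, U) where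
  __ := (X.presheaf.map i.op).hom
  commutes' c := map_scalars k i c

/-- Restriction of sections of a module. -/
def resMod (M : X.Modules) {U V : X.Opens} (i : U ⟶ V) : Γ(M, V) →+ Γ(M, U) :=
  (M.presheaf.map i.op).hom

theorem resAlg_id (U : X.Opensᵒᵖ) (a : Γ(X, U.unop)) : resAlg k (𝟙 U : U ⟶ U).unop a = a := by
  change X.presheaf.map (𝟙 U) a = a
  simp

theorem resAlg_comp {U V W : X.Opensᵒᵖ} (i : U ⟶ V) (j : V ⟶ W) (a : Γ(X, U.unop)) :
    resAlg k (i ≫ j).unop a = resAlg k j.unop (resAlg k i.unop a) := by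
  change X.presheaf.map (i ≫ j) a = X.presheaf.map j (X.presheaf.map i a)
  simp

theorem resMod_id (M : X.Modules) (U : X.Opensᵒᵖ) (m : Γ(M, U.unop)) :
    resMod M (𝟙 U : U ⟶ U).unop m = m := by
  change M.presheaf.map (𝟙 U) m = m
  simp

theorem resMod_comp (M : X.Modules) {U V W : X.Opensᵒᵖ} (i : U ⟶ V) (j : V ⟶ W)
    (m : Γ(M, U.unop)) : resMod M (i ≫ j).unop m = resMod M j.unop (resMod M i.unop m) := by
  change M.presheaf.map (i ≫ j) m = M.presheaf.map j (M.presheaf.map i m)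
  simp

theorem resMod_smul (M : X.Modules) {U V : X.Opens} (i : U ⟶ V) (a : Γ(X, V)) (m : Γ(M, V)) :
    resMod M i (a • m) = resAlg k i a • resMod M i m :=
  Scheme.Modules.map_smul M i a m

/-- The presheaf of abelian groups `U ↦ Pⁿ(Γ(M, U))` of principal parts relative to
`Γ(X, U)` over `k`. -/
def principalPartsAb (n : ℕ) (M : X.Modules) : X.Opensᵒᵖ ⥤ Ab.{u} where
  obj U := AddCommGrpCat.of (PrincipalParts k Γ(X, U.unop) Γ(M, U.unop) n)
  map {U V} i := AddCommGrpCat.ofHom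
    (principalPartsMap k n (resAlg k i.unop) (resMod M i.unop)
        (resMod_smul k M i.unop)).toAddMonoidHom
  map_id U := by
    ext x
    exact principalPartsMap_id k n _ _ _ (resAlg_id k U) (resMod_id M U) x
  map_comp {U V W} i j := by
    ext x
    exact principalPartsMap_comp k n _ _ _ _ _ _ _ _ _ (resAlg_comp k i j) (resMod_comp M i j) x

instance principalPartsAbModule (n : ℕ) (M : X.Modules) (U : X.Opensᵒᵖ) :
    Module (X.ringCatSheaf.obj.obj U) ((principalPartsAb k n M).obj U) :=
  inferInstanceAs (Module Γ(X, U.unop) (PrincipalParts k Γ(X, U.unop) Γ(M, U.unop) n))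

/-- The presheaf of modules `U ↦ Pⁿ(Γ(M, U))`. -/
def principalPartsPresheaf (n : ℕ) (M : X.Modules) : X.PresheafOfModules :=
  PresheafOfModules.ofPresheaf (principalPartsAb k n M) fun _ _ i a x =>
    (principalPartsMap k n (resAlg k i.unop) (resMod M i.unop)
        (resMod_smul k M i.unop)).map_smulₛₗ a x

/-- The sheaf associated with a presheaf of modules. -/
abbrev sheafify (P : X.PresheafOfModules) : X.Modules :=
  (PresheafOfModules.sheafification (𝟙 X.ringCatSheaf.obj)).obj P

/-- Morphisms from an associated sheaf are morphisms from the presheaf. -/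
def sheafifyEquiv (P : X.PresheafOfModules) (M : X.Modules) :
    (sheafify P ⟶ M) ≃ (P ⟶ (Scheme.Modules.toPresheafOfModules X).obj M) :=
  PresheafOfModules.sheafificationHomEquiv (𝟙 X.ringCatSheaf.obj)

theorem sheafifyEquiv_add {P : X.PresheafOfModules} {M : X.Modules} (f g : sheafify P ⟶ M) :
    sheafifyEquiv P M (f + g) = sheafifyEquiv P M f + sheafifyEquiv P M g := rfl

/-- The sheaf of principal parts `Pⁿ_{X/k}(M)`. Sheafification does not change the stalks
`Pⁿ(M_x)` of `principalPartsPresheaf`, nor its sections over affine open subsets when `M` is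
quasi-coherent. -/
def principalPartsSheaf (n : ℕ) (M : X.Modules) : X.Modules :=
  sheafify (principalPartsPresheaf k n M)

/-- The global differential operators of order at most `n` on `M`:
`Γ(X, Dⁿ(M)) = Hom(Pⁿ_{X/k}(M), M)`. -/
abbrev DiffOp (n : ℕ) (M : X.Modules) : Type u := principalPartsSheaf k n M ⟶ M

/-- Multiplication by a scalar, as an endomorphism of the module `M`. -/
def scalarEnd (M : X.Modules) (c : k) : M ⟶ M where
  val := PresheafOfModules.homMk
    { app := fun U => AddCommGrpCat.ofHom
        (DistribSMul.toAddMonoidHom Γ(M, U.unop) (algebraMap k Γ(X, U.unop) c))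
      naturality := fun U V i => by
        ext m
        have h := resMod_smul k M i.unop (algebraMap k Γ(X, U.unop) c) m
        rw [AlgHom.commutes] at h
        exact h.symm }
    (fun U a m => smul_comm (algebraMap k Γ(X, U.unop) c) (show Γ(X, U.unop) from a)
      (show Γ(M, U.unop) from m))

theorem scalarEnd_app (M : X.Modules) (c : k) (U : X.Opens) (m : Γ(M, U)) :
    (scalarEnd k M c).app U m = c • m := rfl

/-- `Hom(N, M)` is a vector space over `k`. -/
instance homModule (N M : X.Modules) : Module k (N ⟶ M) :=
  Module.compHom (N ⟶ M) (R := End M)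
    { toFun := scalarEnd k M
      map_one' := by
        refine Scheme.Modules.hom_ext _ _ fun U => ?_
        ext m
        exact one_smul k (show Γ(M, U) from m)
      map_zero' := by
        refine Scheme.Modules.hom_ext _ _ fun U => ?_
        ext m
        exact zero_smul k (show Γ(M, U) from m)
      map_mul' := fun a b => by
        refine Scheme.Modules.hom_ext _ _ fun U => ?_
        ext m
        exact mul_smul a b (show Γ(M, U) from m)
      map_add' := fun a b => by
        refine Scheme.Modules.hom_ext _ _ fun U => ?_
        ext m
        exact add_smul a b (show Γ(M, U) from m) }

theorem homModule_app (N M : X.Modules) (c : k) (f : N ⟶ M) (U : X.Opens) (m : Γ(N, U)) :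
    (c • f).app U m = c • f.app U m := rfl

theorem sheafifyEquiv_smul {P : X.PresheafOfModules} {M : X.Modules} (c : k)
    (f : sheafify P ⟶ M) :
    sheafifyEquiv P M (c • f) = sheafifyEquiv P M f ≫ (scalarEnd k M c).val := rfl

/-- The universal differential operator `dⁿ : M → Pⁿ_{X/k}(M)`, `m ↦ 1 ⊗ m`. -/
def universalOp (n : ℕ) (M : X.Modules) {U : X.Opens} (m : Γ(M, U)) :
    Γ(principalPartsSheaf k n M, U) :=
  (sheafifyEquiv (principalPartsPresheaf k n M) _ (𝟙 (principalPartsSheaf k n M))).app (op U)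
    (Submodule.Quotient.mk ((1 : Γ(X, U)) ⊗ₜ[k] m) :
      PrincipalParts k Γ(X, U) Γ(M, U) n)

variable {k} in
/-- The action `P · m = P (dⁿ m)` of a differential operator on sections. -/
def DiffOp.act {n : ℕ} {M : X.Modules} (P : DiffOp k n M) {U : X.Opens} (m : Γ(M, U)) :
    Γ(M, U) :=
  P.app U (universalOp k n M m)

section Taylor

variable (V : Type u) [AddCommGroup V] [Module k V]

theorem rTensor_smul {A B : Type u} [CommRing A] [Algebra k A] [CommRing B] [Algebra k B]
    (σ : A →ₐ[k] B) (a : A) (x : A ⊗[k] V) :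
    σ.toLinearMap.rTensor V (a • x) = σ a • σ.toLinearMap.rTensor V x := by
  induction x with
  | zero => simp
  | add x y hx hy => simp only [smul_add, map_add, hx, hy]
  | tmul b m => simp [TensorProduct.smul_tmul']

/-- The presheaf of abelian groups `U ↦ Γ(X, U) ⊗ₖ V`. -/
def constAb (X : Scheme.{u}) [X.Over (Spec (CommRingCat.of k))] : X.Opensᵒᵖ ⥤ Ab.{u} where
  obj U := AddCommGrpCat.of (Γ(X, U.unop) ⊗[k] V)
  map {U W} i := AddCommGrpCat.ofHom
    ((resAlg k i.unop).toLinearMap.rTensor V).toAddMonoidHom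
  map_id U := by
    ext x
    have h : (resAlg k (𝟙 U : U ⟶ U).unop).toLinearMap = LinearMap.id :=
      LinearMap.ext (resAlg_id k U)
    change (resAlg k (𝟙 U : U ⟶ U).unop).toLinearMap.rTensor V x = x
    rw [h, LinearMap.rTensor_id, LinearMap.id_apply]
  map_comp {U W W'} i j := by
    ext x
    have h : (resAlg k (i ≫ j).unop).toLinearMap =
        (resAlg k j.unop).toLinearMap ∘ₗ (resAlg k i.unop).toLinearMap :=
      LinearMap.ext (resAlg_comp k i j)
    change (resAlg k (i ≫ j).unop).toLinearMap.rTensor V x = _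
    rw [h, LinearMap.rTensor_comp]
    rfl

instance constAbModule (U : X.Opensᵒᵖ) : Module (X.ringCatSheaf.obj.obj U) ((constAb k V X).obj U) :=
  inferInstanceAs (Module Γ(X, U.unop) (Γ(X, U.unop) ⊗[k] V))

/-- The presheaf of modules `U ↦ Γ(X, U) ⊗ₖ V`. -/
def constPresheaf (X : Scheme.{u}) [X.Over (Spec (CommRingCat.of k))] : X.PresheafOfModules :=
  PresheafOfModules.ofPresheaf (constAb k V X) fun _ _ i a x =>
    rTensor_smul k V (resAlg k i.unop) a x

/-- The sheaf of modules `O_X ⊗ₖ V`. -/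
def constSheaf (X : Scheme.{u}) [X.Over (Spec (CommRingCat.of k))] : X.Modules :=
  sheafify (constPresheaf k V X)

variable {V}

/-- Sections of `O_X ⊗ₖ V` over `U` to principal parts: `φ ⊗ v ↦ [φ ⊗ v|_U]`. -/
def taylorApp (n : ℕ) (M : X.Modules) (i : V →ₗ[k] Γ(M, ⊤)) (U : X.Opens) :
    Γ(X, U) ⊗[k] V →ₗ[Γ(X, U)] PrincipalParts k Γ(X, U) Γ(M, U) n :=
  (diagonalPower k Γ(X, U) Γ(M, U) n).mkQ ∘ₗ
    TensorProduct.AlgebraTensorModule.map LinearMap.id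
      (semilinearRestrict k (resAlg k (homOfLE le_top : U ⟶ ⊤))
        (resMod M (homOfLE le_top : U ⟶ ⊤)) (resMod_smul k M _) ∘ₗ i)

/-- The Taylor map `dⁿ_V`, on presheaves. -/
def taylorPresheafMap (n : ℕ) (M : X.Modules) (i : V →ₗ[k] Γ(M, ⊤)) :
    constPresheaf k V X ⟶ principalPartsPresheaf k n M :=
  PresheafOfModules.homMk
    { app := fun U => AddCommGrpCat.ofHom (taylorApp k n M i U.unop).toAddMonoidHom
      naturality := fun U W f => by
        ext x
        change taylorApp k n M i W.unop ((resAlg k f.unop).toLinearMap.rTensor V x) =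
          principalPartsMap k n (resAlg k f.unop) (resMod M f.unop) (resMod_smul k M f.unop)
            (taylorApp k n M i U.unop x)
        induction (show Γ(X, U.unop) ⊗[k] V from x) with
        | zero => simp
        | add x y hx hy => simp only [map_add, hx, hy]
        | tmul a v =>
          have h := resMod_comp M (homOfLE le_top : U.unop ⟶ ⊤).op f (i v)
          exact congrArg (fun z => (Submodule.Quotient.mk (resAlg k f.unop a ⊗ₜ z) :
            PrincipalParts k Γ(X, W.unop) Γ(M, W.unop) n)) h }
    (fun U a x => (taylorApp k n M i U.unop).map_smul a x)

/-- The Taylor map `dⁿ_V : O_X ⊗ₖ V → Pⁿ_{X/k}(M)`, `φ ⊗ v ↦ φ ⊗ v mod I ^ (n + 1)`. -/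
def taylorMap (n : ℕ) (M : X.Modules) (i : V →ₗ[k] Γ(M, ⊤)) :
    constSheaf k V X ⟶ principalPartsSheaf k n M :=
  (PresheafOfModules.sheafification (𝟙 X.ringCatSheaf.obj)).map (taylorPresheafMap k n M i)

/-- The cokernel of the Taylor map. -/
def taylorCoker (n : ℕ) (M : X.Modules) (i : V →ₗ[k] Γ(M, ⊤)) : X.Modules :=
  Limits.cokernel (taylorMap k n M i)

end Taylor

/-- The support of a sheaf of modules: the points where the stalk does not vanish. -/
def support (M : X.Modules) : Set X := {x | Nontrivial (M.presheaf.stalk x)}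

/-- The codimension of a subset `Z` of a scheme: the infimum over `z ∈ Z` of the dimension
of the local ring at `z`, which is the coheight of `z` for the specialization order
(so the empty set has codimension `⊤`). -/
def codim (Z : Set X) : ℕ∞ := ⨅ z ∈ Z, Order.coheight z

/-- Serre's condition `S_r`: `depth O_{X, x} ≥ min (r, dim O_{X, x})` for all `x`. Here
`depth O_{X, x} ≥ d` means that there is a regular sequence of length `d`. -/
def SerreCondition (X : Scheme.{u}) (r : ℕ) : Prop :=
  ∀ (x : X) (d : ℕ), d ≤ r → (d : WithBot ℕ∞) ≤ ringKrullDim (X.presheaf.stalk x) →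
    ∃ s : List (X.presheaf.stalk x), s.length = d ∧
      RingTheory.Sequence.IsRegular (X.presheaf.stalk x) s

/-- `M` is locally free of finite rank: every point has an open neighbourhood `U` with an
isomorphism `O_U ^ r ≅ M|_U`, `c ↦ ∑ cᵢ eᵢ`, given by sections `e₁, …, e_r` over `U`. -/
def LocallyFree (M : X.Modules) : Prop :=
  ∀ x : X, ∃ U : X.Opens, x ∈ U ∧ ∃ (r : ℕ) (e : Fin r → Γ(M, U)),
    ∀ (W : X.Opens) (h : W ≤ U), Function.Bijective
      fun c : Fin r → Γ(X, W) => ∑ i, c i • resMod M (homOfLE h) (e i)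

section Projective

attribute [local instance] MvPolynomial.gradedAlgebra

/-- Projective space `P^N` over `k`. -/
def projSpace (N : ℕ) : Scheme.{u} := Proj (MvPolynomial.homogeneousSubmodule (Fin (N + 1)) k)

instance projSpaceOver (N : ℕ) : (projSpace k N).Over (Spec (CommRingCat.of k)) where
  hom := Proj.toSpecZero (MvPolynomial.homogeneousSubmodule (Fin (N + 1)) k) ≫
    Spec.map (CommRingCat.ofHom (algebraMap k (MvPolynomial.homogeneousSubmodule (Fin (N + 1)) k 0)))

/-- `X` is projective over `k`: it is isomorphic to a closed subscheme of some `P^N`. -/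
def IsProjective (X : Scheme.{u}) [X.Over (Spec (CommRingCat.of k))] : Prop :=
  ∃ (N : ℕ) (f : X ⟶ projSpace k N), f.IsOver (Spec (CommRingCat.of k)) ∧ IsClosedImmersion f

/-- The open subset `D₊(x_i)` of projective space. -/
def coordOpen (N : ℕ) (i : Fin (N + 1)) : (projSpace k N).Opens :=
  Proj.basicOpen (MvPolynomial.homogeneousSubmodule (Fin (N + 1)) k) (MvPolynomial.X i)

/-- The function `x_j / x_i` on `D₊(x_i)`. -/
def coordRatio (N : ℕ) (i j : Fin (N + 1)) : Γ(projSpace k N, coordOpen k N i) :=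
  Proj.awayToSection (MvPolynomial.homogeneousSubmodule (Fin (N + 1)) k) (MvPolynomial.X i)
    (HomogeneousLocalization.Away.mk _ (MvPolynomial.isHomogeneous_X k i) 1 (MvPolynomial.X j)
      (by simpa using MvPolynomial.isHomogeneous_X k j))

/-- `L` is isomorphic to `f^* O(1)` for the morphism `f : X → P^N`. The line bundle `O(1)` is
free on `D₊(x_i)` with generator `x_i`, and `x_j = (x_j / x_i) x_i` on `D₊(x_i) ∩ D₊(x_j)`. Hence
an isomorphism `f^* O(1) ≅ L` is a family of generators `e_i` of `L` over `f⁻¹ D₊(x_i)` with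
`e_j = f^*(x_j / x_i) e_i` on the intersections. -/
def IsPullbackTwist {N : ℕ} (f : X ⟶ projSpace k N) (L : X.Modules) : Prop :=
  ∃ e : ∀ i, Γ(L, f ⁻¹ᵁ coordOpen k N i),
    (∀ (i) (W : X.Opens) (h : W ≤ f ⁻¹ᵁ coordOpen k N i), Function.Bijective
      fun c : Γ(X, W) => c • resMod L (homOfLE h) (e i)) ∧
    ∀ (i j) (W : X.Opens) (hi : W ≤ f ⁻¹ᵁ coordOpen k N i) (hj : W ≤ f ⁻¹ᵁ coordOpen k N j),
      resMod L (homOfLE hj) (e j) =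
        resAlg k (homOfLE hi) (f.app (coordOpen k N i) (coordRatio k N i j)) •
          resMod L (homOfLE hi) (e i)

/-- `L` is very ample over `k`: it is isomorphic to `f^* O(1)` for an immersion `f` of `X` into
some projective space over `k`. -/
def IsVeryAmple (L : X.Modules) : Prop :=
  ∃ (N : ℕ) (f : X ⟶ projSpace k N), f.IsOver (Spec (CommRingCat.of k)) ∧ IsImmersion f ∧
    IsPullbackTwist k f L

end Projective

section Restriction

variable {k} {Y : Scheme.{u}} [Y.Over (Spec (CommRingCat.of k))] (j : X ⟶ Y) [IsOpenImmersion j]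
  [j.IsOver (Spec (CommRingCat.of k))] {M : X.Modules} {N : Y.Modules}

theorem appIso_scalars (U : X.Opens) (c : k) :
    (j.appIso U).inv (algebraMap k Γ(X, U) c) = algebraMap k Γ(Y, j ''ᵁ U) c := by
  have h : (j.appIso U).hom (algebraMap k Γ(Y, j ''ᵁ U) c) = algebraMap k Γ(X, U) c := by
    have hj : j ≫ (Y ↘ Spec (CommRingCat.of k)) = X ↘ Spec (CommRingCat.of k) :=
      comp_over j (Spec (CommRingCat.of k))
    have h2 : (Y ↘ Spec (CommRingCat.of k)).appTop ≫
        Y.presheaf.map (homOfLE le_top : j ''ᵁ U ⟶ ⊤).op ≫ (j.appIso U).hom =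
        (X ↘ Spec (CommRingCat.of k)).appTop ≫
          X.presheaf.map (homOfLE le_top : U ⟶ ⊤).op := by
      rw [← hj, Scheme.Hom.appIso_hom', Scheme.Hom.map_appLE, Scheme.Hom.comp_appTop,
        Category.assoc]
      rfl
    exact congrArg (fun φ => φ.hom ((Scheme.ΓSpecIso (CommRingCat.of k)).inv c)) h2
  rw [← h]
  exact congrArg (fun φ => φ.hom (algebraMap k Γ(Y, j ''ᵁ U) c)) (j.appIso U).hom_inv_id

/-- The isomorphism from functions on `U` to functions on its image, as a homomorphism of
`k`-algebras. -/
def imageAlg (U : X.Opens) : Γ(X, U) →ₐ[k] Γ(Y, j ''ᵁ U) where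
  __ := (j.appIso U).inv.hom
  commutes' c := appIso_scalars j U c

/-- The isomorphism from sections of `M ≅ j^* N` over `U` to sections of `N` over its image. -/
def imageMod (ψ : N.restrict j ≅ M) (U : X.Opens) : Γ(M, U) →+ Γ(N, j ''ᵁ U) :=
  (ψ.inv.app U).hom

/-- The inverse isomorphism: restriction of sections of `N` to `U`. -/
def pullMod (ψ : N.restrict j ≅ M) (U : X.Opens) : Γ(N, j ''ᵁ U) →+ Γ(M, U) :=
  (ψ.hom.app U).hom

theorem imageMod_smul (ψ : N.restrict j ≅ M) (U : X.Opens) (a : Γ(X, U)) (m : Γ(M, U)) :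
    imageMod j ψ U (a • m) = imageAlg (k := k) j U a • imageMod j ψ U m :=
  Scheme.Modules.Hom.app_smul ψ.inv a m

theorem pullMod_smul (ψ : N.restrict j ≅ M) (U : X.Opens) (a : Γ(X, U))
    (m : Γ(N, j ''ᵁ U)) :
    pullMod j ψ U (imageAlg (k := k) j U a • m) = a • pullMod j ψ U m :=
  Scheme.Modules.Hom.app_smul ψ.hom (U := U) a m

theorem pullMod_smul_scalar (ψ : N.restrict j ≅ M) (U : X.Opens) (c : k)
    (m : Γ(N, j ''ᵁ U)) : pullMod j ψ U (c • m) = c • pullMod j ψ U m := by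
  have h := pullMod_smul (k := k) j ψ U (algebraMap k _ c) m
  rwa [AlgHom.commutes] at h

theorem imageAlg_res {U W : X.Opens} (f : W ⟶ U) (a : Γ(X, U)) :
    imageAlg (k := k) j W (resAlg k f a) =
      resAlg k (j.opensFunctor.map f) (imageAlg (k := k) j U a) :=
  congrArg (fun φ => φ.hom a) (j.appIso_inv_naturality f.op)

theorem imageMod_res (ψ : N.restrict j ≅ M) {U W : X.Opens} (f : W ⟶ U) (m : Γ(M, U)) :
    imageMod j ψ W (resMod M f m) = resMod N (j.opensFunctor.map f) (imageMod j ψ U m) :=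
  PresheafOfModules.naturality_apply ψ.inv.val f.op m

theorem pullMod_res (ψ : N.restrict j ≅ M) {U W : X.Opens} (f : W ⟶ U)
    (m : Γ(N, j ''ᵁ U)) :
    pullMod j ψ W (resMod N (j.opensFunctor.map f) m) = resMod M f (pullMod j ψ U m) :=
  PresheafOfModules.naturality_apply ψ.hom.val f.op m

theorem principalPartsMap_image_res (ψ : N.restrict j ≅ M) (n : ℕ) {U W : X.Opens} (f : W ⟶ U)
    (x : PrincipalParts k Γ(X, U) Γ(M, U) n) :
    principalPartsMap k n (imageAlg j W) (imageMod j ψ W) (imageMod_smul j ψ W)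
        (principalPartsMap k n (resAlg k f) (resMod M f) (resMod_smul k M f) x) =
      principalPartsMap k n (resAlg k (j.opensFunctor.map f)) (resMod N (j.opensFunctor.map f))
        (resMod_smul k N (j.opensFunctor.map f))
        (principalPartsMap k n (imageAlg j U) (imageMod j ψ U) (imageMod_smul j ψ U) x) := by
  induction x using principalParts_induction with
  | hadd x y hx hy => simp only [map_add, hx, hy]
  | hmk a m =>
    simp only [principalPartsMap_mk]
    rw [imageAlg_res, imageMod_res]

/-- A differential operator as a linear map on the principal parts over `U`. -/
def diffOpApp {n : ℕ} {M : X.Modules} (P : DiffOp k n M) (U : X.Opens) :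
    PrincipalParts k Γ(X, U) Γ(M, U) n →ₗ[Γ(X, U)] Γ(M, U) :=
  ((sheafifyEquiv (principalPartsPresheaf k n M) M P).app (op U)).hom

theorem DiffOp.act_eq {n : ℕ} {M : X.Modules} (P : DiffOp k n M) {U : X.Opens} (m : Γ(M, U)) :
    P.act m = diffOpApp P U (Submodule.Quotient.mk ((1 : Γ(X, U)) ⊗ₜ[k] m)) := rfl

theorem diffOpApp_map {n : ℕ} {M : X.Modules} (P : DiffOp k n M) {U V : X.Opens} (i : U ⟶ V)
    (x : PrincipalParts k Γ(X, V) Γ(M, V) n) :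
    diffOpApp P U (principalPartsMap k n (resAlg k i) (resMod M i) (resMod_smul k M i) x) =
      resMod M i (diffOpApp P V x) :=
  PresheafOfModules.naturality_apply
    (sheafifyEquiv (principalPartsPresheaf k n M) M P) i.op x

/-- The restriction of a differential operator over `U`: it is the given differential operator
over the image of `U`. -/
def restrictApp (ψ : N.restrict j ≅ M) {n : ℕ} (P : DiffOp k n N) (U : X.Opens) :
    PrincipalParts k Γ(X, U) Γ(M, U) n →ₗ[Γ(X, U)] Γ(M, U) where
  toFun x := pullMod j ψ U (diffOpApp P (j ''ᵁ U)
    (principalPartsMap k n (imageAlg j U) (imageMod j ψ U) (imageMod_smul j ψ U) x))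
  map_add' x y := by simp only [map_add]
  map_smul' a x := by
    rw [LinearMap.map_smulₛₗ, RingHom.id_apply, ← pullMod_smul (k := k) j ψ U]
    exact congrArg (pullMod j ψ U) ((diffOpApp P (j ''ᵁ U)).map_smul _ _)

theorem restrictApp_map (ψ : N.restrict j ≅ M) {n : ℕ} (P : DiffOp k n N) {U W : X.Opens}
    (f : W ⟶ U) (x : PrincipalParts k Γ(X, U) Γ(M, U) n) :
    restrictApp j ψ P W
        (principalPartsMap k n (resAlg k f) (resMod M f) (resMod_smul k M f) x) =
      resMod M f (restrictApp j ψ P U x) := by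
  change pullMod j ψ W (diffOpApp P (j ''ᵁ W) (principalPartsMap k n _ _ _
    (principalPartsMap k n _ _ _ x))) = resMod M f (pullMod j ψ U _)
  rw [principalPartsMap_image_res, ← pullMod_res, diffOpApp_map]

/-- The morphism of presheaves given by the maps `restrictApp`. -/
def restrictPresheafMap (ψ : N.restrict j ≅ M) {n : ℕ} (P : DiffOp k n N) :
    principalPartsPresheaf k n M ⟶ (Scheme.Modules.toPresheafOfModules X).obj M :=
  PresheafOfModules.homMk
    { app := fun U => AddCommGrpCat.ofHom (restrictApp j ψ P U.unop).toAddMonoidHom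
      naturality := fun U W f => by
        ext x
        exact restrictApp_map j ψ P f.unop x }
    (fun U a x => (restrictApp j ψ P U.unop).map_smul a x)

variable (k) in
/-- The restriction of differential operators along an open immersion `j : X → Y` and an
isomorphism `ψ : j^* N ≅ M`. -/
def restrictOp (ψ : N.restrict j ≅ M) (n : ℕ) : DiffOp k n N →ₗ[k] DiffOp k n M where
  toFun P := (sheafifyEquiv _ _).symm (restrictPresheafMap j ψ P)
  map_add' P Q := by
    apply (sheafifyEquiv _ _).injective
    refine Eq.trans ?_ (sheafifyEquiv_add _ _).symm
    rw [Equiv.apply_symm_apply, Equiv.apply_symm_apply, Equiv.apply_symm_apply]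
    ext U x
    exact (pullMod j ψ U.unop).map_add _ _
  map_smul' c P := by
    apply (sheafifyEquiv _ _).injective
    refine Eq.trans ?_ (sheafifyEquiv_smul k c _).symm
    rw [Equiv.apply_symm_apply, Equiv.apply_symm_apply]
    ext U x
    exact pullMod_smul_scalar j ψ U.unop c _

/-- The restricted operator acts as the given one on sections over the image of `U`. -/
theorem restrictOp_act (ψ : N.restrict j ≅ M) {n : ℕ} (P : DiffOp k n N) {U : X.Opens}
    (m : Γ(M, U)) :
    (restrictOp k j ψ n P).act m = pullMod j ψ U (P.act (imageMod j ψ U m)) := by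
  rw [DiffOp.act_eq, DiffOp.act_eq]
  have h : diffOpApp (restrictOp k j ψ n P) U = restrictApp j ψ P U := by
    change ((sheafifyEquiv _ _ ((sheafifyEquiv _ _).symm
      (restrictPresheafMap j ψ P))).app (op U)).hom = _
    rw [Equiv.apply_symm_apply]
    rfl
  rw [h]
  change pullMod j ψ U (diffOpApp P _ (principalPartsMap k n _ _ _ _)) = _
  rw [principalPartsMap_mk, map_one]

end Restriction

/-- `Γ(X, D^{n,V}(M))`: the global differential operators `P` of order at most `n` on `M` that
preserve (the image of) `V`. -/
def preserving (n : ℕ) (M : X.Modules) {V : Type u} [AddCommGroup V] [Module k V]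
    (i : V →ₗ[k] Γ(M, ⊤)) : Submodule k (DiffOp k n M) where
  carrier := {P | ∀ v, ∃ w, P.act (i v) = i w}
  add_mem' {P Q} hP hQ v := by
    obtain ⟨w, hw⟩ := hP v
    obtain ⟨z, hz⟩ := hQ v
    refine ⟨w + z, ?_⟩
    rw [map_add, ← hw, ← hz]
    rfl
  zero_mem' v := ⟨0, by rw [map_zero]; rfl⟩
  smul_mem' c P hP v := by
    obtain ⟨w, hw⟩ := hP v
    refine ⟨c • w, ?_⟩
    rw [map_smul, ← hw]
    rfl

end Scheme

/-- A variety `X` over `k` (an irreducible scheme of finite type) with a locally free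
`O_X`-module `M` of finite rank and a finite-dimensional vector space `V` of global sections of
`M`, given by an injective linear map `i : V → Γ(X, M)`. -/
structure LinearSystem (k : Type u) [Field k] where
  /-- the variety -/
  X : Scheme.{u}
  [overBase : X.Over (Spec (CommRingCat.of k))]
  [irreducible : IrreducibleSpace X]
  [locallyOfFiniteType : LocallyOfFiniteType (X ↘ Spec (CommRingCat.of k))]
  [quasiCompact : QuasiCompact (X ↘ Spec (CommRingCat.of k))]
  /-- the module -/
  M : X.Modules
  locallyFree : LocallyFree M
  /-- the vector space -/
  V : Type u
  [addCommGroup : AddCommGroup V]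
  [module : Module k V]
  [finite : FiniteDimensional k V]
  /-- the inclusion of `V` in the global sections -/
  i : V →ₗ[k] Γ(M, ⊤)
  injective : Function.Injective i

attribute [instance] LinearSystem.overBase LinearSystem.irreducible
  LinearSystem.locallyOfFiniteType LinearSystem.quasiCompact LinearSystem.addCommGroup
  LinearSystem.module LinearSystem.finite

/-- A full completion `A → B`: an open immersion `j` of the variety of `A` into the projective
variety of `B`, an isomorphism `ψ : j^* M_B ≅ M_A` (here `j^*` is restriction to an open
subscheme) and an isomorphism `F : V_B ≅ V_A` induced by `ψ`, such that `V_B → Γ(X_B, M_B)` is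
an isomorphism. -/
structure FullCompletion {k : Type u} [Field k] (A B : LinearSystem k) where
  /-- the open immersion -/
  j : A.X ⟶ B.X
  [isOver : j.IsOver (Spec (CommRingCat.of k))]
  [isOpenImmersion : IsOpenImmersion j]
  projective : IsProjective k B.X
  /-- the isomorphism of modules -/
  ψ : B.M.restrict j ≅ A.M
  /-- the isomorphism of vector spaces -/
  F : B.V ≃ₗ[k] A.V
  /-- `F` is the restriction of sections `Γ(ψ)` -/
  compatible : ∀ v : B.V, A.i (F v) =
    pullMod j ψ ⊤ (resMod B.M (homOfLE le_top : j ''ᵁ ⊤ ⟶ ⊤) (B.i v))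
  full : Function.Bijective B.i

attribute [instance] FullCompletion.isOver FullCompletion.isOpenImmersion

end DiffOps

end

/-! A differential operator on the completion is a compatible family of linear maps on principal
parts. On a scheme that is irreducible, locally noetherian and `S₁`, a section of a locally free
module is determined by its restriction to any open set containing the generic point
(`resMod_injective`). The image of `A.X` is such an open set, so operators are determined by their
restrictions. Since `B.V` is all of `Γ(B.X, B.M)`, every global operator preserves it and its
restriction preserves `A.V`.

For surjectivity, let `Q` preserve `A.V`. For a principal part `p` over an open `U` of the
completion, `Q` has a value on `p` over `U ∩ A.X`, and the question is whether this section extends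
to `U`; extensions are unique, so they then form an operator (`exists_restrictOp_eq`). If `p` is a
combination of Taylor expansions of elements of `B.V`, the value extends, because `Q` sends each
element of `A.V` to the restriction of a global section (`exists_isValue_taylorApp`). Hence values
extend near every point where the Taylor map is surjective, and such local extensions glue.

Under `S₂`, surjectivity at points of codimension at most one suffices, by a Hartogs argument: if `q
= b / s` is not regular, an associated prime of `b` modulo `s` gives a point whose local ring has
depth at most one, hence dimension at most one, and there `q` was assumed regular
(`exists_germ_eq_of_coheight_le_one`).

For a very ample line bundle and `n = 1` the Taylor map is surjective everywhere. With `e` the local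
generator `x_l`, the functions `a` such that the jet of `a • e` lies in the image form an algebra
closed under division by units. It contains the ratios `x_j / x_l`, since the coordinates are global
sections, and these generate all local functions up to such division, because stalk maps of an
immersion are surjective (`taylorSurjectiveAt_of_isVeryAmple`). -/

noncomputable section

namespace DiffOps

/-! ### Associated primes and local rings of small depth. -/

section Depth

open RingTheory.Sequence IsLocalRing
open scoped Pointwise

/-- An element outside a principal ideal has a multiple whose annihilator modulo that ideal
is prime. -/
theorem exists_prime_colon {R : Type*} [CommRing R] [IsNoetherianRing R] {s b : R}
    (hb : ¬ s ∣ b) :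
    ∃ (c : R) (p : Ideal R), p.IsPrime ∧ ∀ a, a ∈ p ↔ s ∣ a * (c * b) := by
  have hmem : ∀ z, Ideal.Quotient.mk (Ideal.span {s}) z = 0 ↔ s ∣ z := fun z => by
    rw [Ideal.Quotient.eq_zero_iff_mem, Ideal.mem_span_singleton]
  let N := Submodule.span R {Ideal.Quotient.mk (Ideal.span {s}) b}
  have h0 : (⟨_, Submodule.mem_span_singleton_self _⟩ : N) ≠ 0 := fun h =>
    hb ((hmem b).1 (congrArg Subtype.val h))
  -- The associated prime is taken in the cyclic submodule generated by the class of `b`, not in the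
  -- whole quotient, so that its witness is a multiple of `b`.
  obtain ⟨p, hp, -⟩ := exists_le_isAssociatedPrime_of_isNoetherianRing R _ h0
  rw [isAssociatedPrime_iff] at hp
  obtain ⟨hp, ⟨y, hyN⟩, hy⟩ := hp
  obtain ⟨c, rfl⟩ := Submodule.mem_span_singleton.1 hyN
  refine ⟨c, p, hp, fun a => ?_⟩
  rw [hy, Submodule.mem_colon_singleton, Submodule.mem_bot, ← hmem, ← Subtype.coe_inj]
  rfl

theorem mem_maximalIdeal_of_isRegular {L : Type*} [CommRing L] [IsLocalRing L] {l : List L}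
    (hl : IsRegular L l) {x : L} (hx : x ∈ l) : x ∈ maximalIdeal L := by
  rw [mem_maximalIdeal, mem_nonunits_iff]
  intro hu
  refine hl.top_ne_smul ?_
  rw [Ideal.eq_top_of_isUnit_mem (Ideal.ofList l) (Ideal.subset_span hx) hu, Submodule.top_smul]

/-- Depth zero: a regular element lies in the maximal ideal, hence kills `z`, which contradicts its
regularity. -/
theorem not_isRegular_singleton {L : Type*} [CommRing L] [IsLocalRing L] {z : L} (hz : z ≠ 0)
    (h : ∀ a ∈ maximalIdeal L, a * z = 0) {l : List L} (hl : l.length = 1) :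
    ¬ IsRegular L l := by
  obtain ⟨x, rfl⟩ := List.length_eq_one_iff.1 hl
  intro hr
  have hx := mem_maximalIdeal_of_isRegular hr (x := x) (by simp)
  rw [isRegular_cons_iff] at hr
  exact hz (hr.1 (by simpa using h x hx))

/-- Depth at most one: `z` is a nonzero socle element modulo the regular element `s`. For a regular
pair `x, y`, write `x z = s w` and `y z = s v`; then `y w = x v`, so `x ∣ w` by regularity of `y`
modulo `x`, and cancelling `x` gives `s ∣ z`. This direct computation replaces the invariance of the
length of maximal regular sequences. -/
theorem not_isRegular_pair {L : Type*} [CommRing L] [IsLocalRing L] {s z : L}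
    (hs : s ∈ nonZeroDivisors L) (hz : ¬ s ∣ z)
    (h : ∀ a ∈ maximalIdeal L, s ∣ a * z) {l : List L} (hl : l.length = 2) :
    ¬ IsRegular L l := by
  obtain ⟨x, y, rfl⟩ := List.length_eq_two.1 hl
  intro hr
  have hx := mem_maximalIdeal_of_isRegular hr (x := x) (by simp)
  have hy := mem_maximalIdeal_of_isRegular hr (x := y) (by simp)
  rw [isRegular_cons_iff, isRegular_cons_iff] at hr
  obtain ⟨w, hw⟩ := h x hx
  obtain ⟨v, hv⟩ := h y hy
  have key : y * w = x * v := by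
    rw [← mul_cancel_left_mem_nonZeroDivisors hs]
    linear_combination x * hv - y * hw
  have hmem : ∀ t : L, t ∈ x • (⊤ : Submodule L L) ↔ x ∣ t := fun t => by
    simp [Submodule.mem_smul_pointwise_iff_exists, dvd_def, eq_comm]
  have hw' : x ∣ w := by
    rw [← hmem, ← Submodule.Quotient.mk_eq_zero]
    refine hr.2.1 ?_
    change y • (Submodule.Quotient.mk w : L ⧸ x • (⊤ : Submodule L L)) =
      y • (0 : L ⧸ x • (⊤ : Submodule L L))
    rw [smul_zero, ← Submodule.Quotient.mk_smul, Submodule.Quotient.mk_eq_zero, hmem]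
    exact ⟨v, key⟩
  obtain ⟨w', rfl⟩ := hw'
  refine hz ⟨w', hr.1 ?_⟩
  change x * z = x * (s * w')
  linear_combination hw

/-- If `p` is the annihilator of `z` modulo `s`, then `s` does not divide `z` in the local ring
at `p`, but it divides the multiples of `z` by the maximal ideal. -/
theorem localization_colon {R : Type*} [CommRing R] {s z : R} {p : Ideal R} [p.IsPrime]
    (hp : ∀ a, a ∈ p ↔ s ∣ a * z) (L : Type*) [CommRing L] [Algebra R L] [IsLocalRing L]
    [IsLocalization.AtPrime L p] :
    ¬ algebraMap R L s ∣ algebraMap R L z ∧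
      ∀ a ∈ maximalIdeal L, algebraMap R L s ∣ a * algebraMap R L z := by
  constructor
  · rintro ⟨w, hw⟩
    obtain ⟨⟨r, u⟩, hr⟩ := IsLocalization.surj p.primeCompl w
    have : algebraMap R L (u * z) = algebraMap R L (s * r) := by
      rw [map_mul, map_mul, hw, ← hr]; ring
    obtain ⟨v, hv⟩ := (IsLocalization.eq_iff_exists p.primeCompl L).1 this
    -- Clearing denominators puts the denominator `v * u` in the colon ideal `p`, although it lies
    -- outside `p`.
    refine (v * u).2 ((hp _).2 ⟨v * r, ?_⟩)
    rw [Submonoid.coe_mul]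
    linear_combination hv
  · intro a ha
    obtain ⟨⟨r, u⟩, hr⟩ := IsLocalization.surj p.primeCompl a
    have hu := IsLocalization.map_units L u
    have hrp : r ∈ p := by
      rw [← IsLocalization.AtPrime.to_map_mem_maximal_iff L p r, ← hr]
      exact Ideal.mul_mem_right _ _ ha
    have := map_dvd (algebraMap R L) ((hp r).1 hrp)
    rw [map_mul, ← hr] at this
    rw [← hu.dvd_mul_left]
    convert this using 1
    ring

end Depth

/-! ### Functions on `S₁` and `S₂` schemes. -/

section Sections

variable {Y : Scheme.{u}}

/-- The contrapositive use of Serre's condition: small depth forces small dimension, and the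
dimension of the stalk is the coheight of the point. -/
theorem coheight_lt_of_not_exists_isRegular {r : ℕ} (hS : SerreCondition Y r) {x : Y} {d : ℕ}
    (hd : d ≤ r)
    (h : ∀ s : List (Y.presheaf.stalk x), s.length = d →
      ¬ RingTheory.Sequence.IsRegular (Y.presheaf.stalk x) s) :
    Order.coheight x < d := by
  by_contra! hlt
  obtain ⟨s, hs, hr⟩ := hS x d hd (by
    rw [ringKrullDim_stalk_eq_coheight]
    exact_mod_cast hlt)
  exact h s hs hr

variable [IrreducibleSpace Y]

theorem genericPoint_mem {U : Y.Opens} {x : Y} (hx : x ∈ U) : genericPoint Y ∈ U :=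
  (genericPoint_specializes x).mem_open U.2 hx

theorem eq_genericPoint_of_coheight_eq_zero {x : Y} (hx : Order.coheight x = 0) :
    x = genericPoint Y := by
  rw [Order.coheight_eq_zero] at hx
  have h1 : x ≤ genericPoint Y := genericPoint_specializes x
  have h2 : x ⤳ genericPoint Y := hx h1
  exact (h2.antisymm h1).eq

variable [IsLocallyNoetherian Y]

/-- On an irreducible locally noetherian scheme without embedded points, a function is determined
by its germ at the generic point. -/
theorem eq_zero_of_germ_genericPoint (hS : SerreCondition Y 1) {U : Y.Opens}
    (hU : genericPoint Y ∈ U) {f : Γ(Y, U)} (hf : Y.presheaf.germ U _ hU f = 0) : f = 0 := by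
  wlog hA : IsAffineOpen U generalizing U
  · refine TopCat.Presheaf.section_ext Y.sheaf U _ _ fun x hx => ?_
    obtain ⟨W, hW, hxW, hWU⟩ := exists_isAffineOpen_mem_and_subset hx
    replace hWU : W ≤ U := hWU
    have h := this (genericPoint_mem hxW) (f := Y.presheaf.map (homOfLE hWU).op f)
      (by rw [TopCat.Presheaf.germ_res_apply, hf]) hW
    have h' := congrArg (Y.presheaf.germ W x hxW) h
    rw [TopCat.Presheaf.germ_res_apply] at h'
    exact h'.trans ((map_zero (Y.presheaf.germ W x hxW).hom).trans
      (map_zero (Y.presheaf.germ U x hx).hom).symm)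
  by_contra h0
  have := IsLocallyNoetherian.component_noetherian ⟨U, hA⟩
  -- Vanishing is divisibility by `0`, so the colon lemmas apply with `s = 0` and yield an
  -- associated point of the scheme; `S₁` forces it to be the generic point, where the germ of `f`
  -- vanishes.
  rw [← zero_dvd_iff] at h0
  obtain ⟨c, p, hp, hpc⟩ := exists_prime_colon h0
  let y : PrimeSpectrum Γ(Y, U) := ⟨p, hp⟩
  have hy : hA.fromSpec y ∈ U := hA.opensRange_fromSpec.le ⟨y, rfl⟩
  let := TopCat.Presheaf.algebra_section_stalk Y.presheaf ⟨hA.fromSpec y, hy⟩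
  have : IsLocalization.AtPrime (Y.presheaf.stalk (hA.fromSpec y)) p :=
    hA.isLocalization_stalk' y hy
  obtain ⟨h1, h2⟩ := localization_colon hpc (Y.presheaf.stalk (hA.fromSpec y))
  rw [map_zero, zero_dvd_iff] at h1
  simp only [map_zero, zero_dvd_iff] at h2
  have hlt := coheight_lt_of_not_exists_isRegular hS le_rfl
    fun s hs => not_isRegular_singleton h1 h2 hs
  have hη := eq_genericPoint_of_coheight_eq_zero (x := hA.fromSpec y)
    (by simpa using hlt)
  refine h1 ?_
  change Y.presheaf.germ U (hA.fromSpec y) hy (c * f) = 0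
  have : ∀ (x : Y) (hx : x ∈ U), x = genericPoint Y → Y.presheaf.germ U x hx (c * f) = 0 := by
    rintro x hx rfl
    rw [map_mul, hf, mul_zero]
  exact this _ hy hη

/-- On an irreducible locally noetherian scheme satisfying `S₂`, a rational function which is
regular at all points of codimension at most `1` is regular. -/
theorem exists_germ_eq_of_coheight_le_one (hS : SerreCondition Y 2) {U : Y.Opens}
    (hA : IsAffineOpen U) (hU : genericPoint Y ∈ U) (q : Y.presheaf.stalk (genericPoint Y))
    (h : ∀ x ∈ U, Order.coheight x ≤ 1 → ∃ (T : Y.Opens) (_ : x ∈ T) (hT : genericPoint Y ∈ T)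
      (m : Γ(Y, T)), Y.presheaf.germ T _ hT m = q) :
    ∃ f : Γ(Y, U), Y.presheaf.germ U _ hU f = q := by
  have hS1 : SerreCondition Y 1 := fun x d hd => hS x d (hd.trans one_le_two)
  have := IsLocallyNoetherian.component_noetherian ⟨U, hA⟩
  let := TopCat.Presheaf.algebra_section_stalk Y.presheaf (⟨genericPoint Y, hU⟩ : U)
  have hloc := hA.isLocalization_stalk ⟨genericPoint Y, hU⟩
  -- The rational function is a fraction `q = b / s` on the affine `U`; it is regular on `U` once `s
  -- ∣ b`.
  obtain ⟨⟨b, s, hs⟩, hbs⟩ := IsLocalization.surj (hA.primeIdealOf ⟨_, hU⟩).asIdeal.primeCompl q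
  have hsu := IsLocalization.map_units (Y.presheaf.stalk (genericPoint Y))
    (⟨s, hs⟩ : (hA.primeIdealOf ⟨_, hU⟩).asIdeal.primeCompl)
  change q * Y.presheaf.germ U _ hU s = Y.presheaf.germ U _ hU b at hbs
  change IsUnit (Y.presheaf.germ U _ hU s) at hsu
  by_cases hdvd : s ∣ b
  · obtain ⟨f, rfl⟩ := hdvd
    refine ⟨f, ?_⟩
    rw [map_mul, mul_comm q] at hbs
    exact (hsu.mul_left_cancel hbs).symm
  exfalso
  have hsn : s ∈ nonZeroDivisors Γ(Y, U) := by
    refine mem_nonZeroDivisors_iff_right.2 fun t ht => eq_zero_of_germ_genericPoint hS1 hU ?_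
    have := congrArg (Y.presheaf.germ U _ hU) ht
    rwa [map_mul, map_zero, hsu.mul_left_eq_zero] at this
  obtain ⟨c, p, hp, hpc⟩ := exists_prime_colon hdvd
  let y : PrimeSpectrum Γ(Y, U) := ⟨p, hp⟩
  have hy : hA.fromSpec y ∈ U := hA.opensRange_fromSpec.le ⟨y, rfl⟩
  let := TopCat.Presheaf.algebra_section_stalk Y.presheaf ⟨hA.fromSpec y, hy⟩
  have : IsLocalization.AtPrime (Y.presheaf.stalk (hA.fromSpec y)) p :=
    hA.isLocalization_stalk' y hy
  obtain ⟨h1, h2⟩ := localization_colon hpc (Y.presheaf.stalk (hA.fromSpec y))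
  have hlt := coheight_lt_of_not_exists_isRegular hS le_rfl fun l hl =>
    not_isRegular_pair (IsLocalization.map_nonZeroDivisors_le p.primeCompl _
      ⟨s, hsn, rfl⟩) h1 h2 hl
  -- The point of `p` has coheight less than `2`, so `q` is a function `m` near it. Then `s * m = b`
  -- holds at the generic point, hence on `U ⊓ T`, and `s` divides `b` in the stalk, against the
  -- choice of `p`.
  obtain ⟨T, hxT, hT, m, rfl⟩ := h _ hy (ENat.lt_natCast_add_one_iff.1 hlt)
  have hUT : genericPoint Y ∈ U ⊓ T := ⟨hU, hT⟩
  have hsm : Y.presheaf.map (homOfLE inf_le_left : U ⊓ T ⟶ U).op s *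
      Y.presheaf.map (homOfLE inf_le_right : U ⊓ T ⟶ T).op m =
      Y.presheaf.map (homOfLE inf_le_left : U ⊓ T ⟶ U).op b := by
    rw [← sub_eq_zero]
    refine eq_zero_of_germ_genericPoint hS1 hUT ?_
    rw [map_sub, map_mul, TopCat.Presheaf.germ_res_apply, TopCat.Presheaf.germ_res_apply,
      TopCat.Presheaf.germ_res_apply, ← hbs, mul_comm, sub_self]
  have hdvd' : ∀ (x : Y) (hxU : x ∈ U), x ∈ T →
      Y.presheaf.germ U x hxU s ∣ Y.presheaf.germ U x hxU b := fun x hxU hxT => by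
    have hxUT : x ∈ U ⊓ T := ⟨hxU, hxT⟩
    have hx := congrArg (Y.presheaf.germ (U ⊓ T) x hxUT) hsm
    rw [map_mul, TopCat.Presheaf.germ_res_apply, TopCat.Presheaf.germ_res_apply,
      TopCat.Presheaf.germ_res_apply] at hx
    exact ⟨_, hx.symm⟩
  refine h1 ?_
  rw [map_mul]
  exact Dvd.dvd.mul_left (hdvd' _ hy hxT) _

end Sections

/-! ### Restriction and extension of sections of locally free modules. -/

section Modules

variable {k : Type u} [Field k] {Y : Scheme.{u}} [Y.Over (Spec (CommRingCat.of k))]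
  {N : Y.Modules}

theorem resMod_resMod {U V W : Y.Opens} (i : V ⟶ U) (j : W ⟶ V) (l : W ⟶ U) (m : Γ(N, U)) :
    resMod N j (resMod N i m) = resMod N l m :=
  (resMod_comp N i.op j.op m).symm

theorem resAlg_resAlg {U V W : Y.Opens} (i : V ⟶ U) (j : W ⟶ V) (l : W ⟶ U) (a : Γ(Y, U)) :
    resAlg k j (resAlg k i a) = resAlg k l a :=
  (resAlg_comp k i.op j.op a).symm

theorem resMod_self {U : Y.Opens} (i : U ⟶ U) (m : Γ(N, U)) : resMod N i m = m :=
  resMod_id N (op U) m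

/-- Sections which agree locally are equal. -/
theorem section_ext_of_locally {U : Y.Opens} {m m' : Γ(N, U)}
    (h : ∀ x ∈ U, ∃ (T : Y.Opens) (hT : T ≤ U), x ∈ T ∧
      resMod N (homOfLE hT) m = resMod N (homOfLE hT) m') : m = m' := by
  choose T hT hxT heq using fun x : U => h x.1 x.2
  exact TopCat.Sheaf.eq_of_locally_eq' ⟨N.presheaf, N.isSheaf⟩ T U (fun x => homOfLE (hT x))
    (fun x hx => Opens.mem_iSup.2 ⟨⟨x, hx⟩, hxT ⟨x, hx⟩⟩) m m' heq

theorem sum_smul_res {r : ℕ} {U V W : Y.Opens} (hV : V ≤ U) (hW : W ≤ V) (e : Fin r → Γ(N, U))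
    (c : Fin r → Γ(Y, V)) :
    resMod N (homOfLE hW) (∑ i, c i • resMod N (homOfLE hV) (e i)) =
      ∑ i, resAlg k (homOfLE hW) (c i) • resMod N (homOfLE (hW.trans hV)) (e i) := by
  rw [map_sum]
  refine Finset.sum_congr rfl fun i _ => ?_
  rw [resMod_smul k, resMod_resMod _ _ (homOfLE (hW.trans hV))]

variable [IrreducibleSpace Y] [IsLocallyNoetherian Y]

variable (k) in
theorem resAlg_injective (hS : SerreCondition Y 1) {U W : Y.Opens} (hWU : W ≤ U)
    (hW : genericPoint Y ∈ W) : Function.Injective (resAlg k (homOfLE hWU)) := by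
  rw [injective_iff_map_eq_zero]
  intro a ha
  refine eq_zero_of_germ_genericPoint hS (hWU hW) ?_
  rw [← TopCat.Presheaf.germ_res_apply Y.presheaf (homOfLE hWU) _ hW]
  exact (congrArg (Y.presheaf.germ W _ hW) ha).trans (map_zero (Y.presheaf.germ W _ hW).hom)

/-- Without embedded points, the restriction of sections of a locally free module to a nonempty
open subset is injective. -/
theorem resMod_injective (k : Type u) [Field k]
    [Y.Over (Spec (CommRingCat.of k))] (hN : LocallyFree N) (hS : SerreCondition Y 1) {U W : Y.Opens}
    (hWU : W ≤ U) (hW : genericPoint Y ∈ W) : Function.Injective (resMod N (homOfLE hWU)) := by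
  rw [injective_iff_map_eq_zero]
  intro m hm
  refine section_ext_of_locally fun x hx => ?_
  obtain ⟨T, hxT, r, e, he⟩ := hN x
  refine ⟨U ⊓ T, inf_le_left, ⟨hx, hxT⟩, ?_⟩
  obtain ⟨c, hc⟩ := (he (U ⊓ T) inf_le_right).2 (resMod N (homOfLE inf_le_left) m)
  have hle : W ⊓ T ≤ U ⊓ T := inf_le_inf_right T hWU
  have hWT : genericPoint Y ∈ W ⊓ T := ⟨hW, genericPoint_mem hxT⟩
  have h0 : (fun i => resAlg k (homOfLE hle) (c i)) = 0 := by
    refine (he (W ⊓ T) inf_le_right).1 ?_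
    have := congrArg (resMod N (homOfLE hle)) hc
    dsimp only at this
    rw [sum_smul_res (k := k), resMod_resMod _ _ (homOfLE (hle.trans inf_le_left)),
      ← resMod_resMod (homOfLE hWU) (homOfLE inf_le_left), hm, map_zero] at this
    simpa using this
  have hc0 : c = 0 := funext fun i => resAlg_injective k hS hle hWT
    ((congrFun h0 i).trans (map_zero _).symm)
  rw [← hc, hc0, map_zero]
  simp

/-- Local extensions of a section over a nonempty open subset glue. -/
theorem exists_extension_of_forall_mem (k : Type u) [Field k]
    [Y.Over (Spec (CommRingCat.of k))] (hN : LocallyFree N) (hS : SerreCondition Y 1)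
    {U W : Y.Opens} (hWU : W ≤ U) (hW : genericPoint Y ∈ W) (q : Γ(N, W))
    (h : ∀ x ∈ U, ∃ (T : Y.Opens), T ≤ U ∧ x ∈ T ∧ ∃ m : Γ(N, T),
      resMod N (homOfLE inf_le_right : W ⊓ T ⟶ T) m =
        resMod N (homOfLE inf_le_left : W ⊓ T ⟶ W) q) :
    ∃ m : Γ(N, U), resMod N (homOfLE hWU) m = q := by
  choose T hT hxT m hm using fun x : U => h x.1 x.2
  have hcompat : TopCat.Presheaf.IsCompatible N.presheaf T m := fun x y => by
    -- Two local extensions both restrict to `q` on this smaller set, which contains the generic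
    -- point; injectivity of restriction makes them agree on the whole overlap.
    have hle : W ⊓ (T x ⊓ T y) ≤ T x ⊓ T y := inf_le_right
    refine resMod_injective k hN hS hle
      ⟨hW, genericPoint_mem (hxT x), genericPoint_mem (hxT y)⟩ ?_
    change resMod N (homOfLE hle) (resMod N (homOfLE inf_le_left) (m x)) =
      resMod N (homOfLE hle) (resMod N (homOfLE inf_le_right) (m y))
    have h1 : W ⊓ (T x ⊓ T y) ≤ W ⊓ T x := inf_le_inf_left _ inf_le_left
    have h2 : W ⊓ (T x ⊓ T y) ≤ W ⊓ T y := inf_le_inf_left _ inf_le_right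
    have e1 := congrArg (resMod N (homOfLE h1)) (hm x)
    have e2 := congrArg (resMod N (homOfLE h2)) (hm y)
    rw [resMod_resMod _ _ (homOfLE (h1.trans inf_le_right)),
      resMod_resMod _ _ (homOfLE inf_le_left)] at e1
    rw [resMod_resMod _ _ (homOfLE (h2.trans inf_le_right)),
      resMod_resMod _ _ (homOfLE inf_le_left)] at e2
    rw [resMod_resMod _ _ (homOfLE (h1.trans inf_le_right)),
      resMod_resMod _ _ (homOfLE (h2.trans inf_le_right)), e1, e2]
  obtain ⟨M, hM, -⟩ := TopCat.Sheaf.existsUnique_gluing' ⟨N.presheaf, N.isSheaf⟩ T U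
    (fun x => homOfLE (hT x)) (fun x hx => Opens.mem_iSup.2 ⟨⟨x, hx⟩, hxT ⟨x, hx⟩⟩) m hcompat
  refine ⟨M, section_ext_of_locally fun x hx => ⟨W ⊓ T ⟨x, hWU hx⟩, inf_le_left,
    ⟨hx, hxT _⟩, ?_⟩⟩
  rw [← hm, ← hM, resMod_resMod _ _ (homOfLE (inf_le_left.trans hWU))]
  exact (resMod_resMod _ _ (homOfLE (inf_le_left.trans hWU)) M).symm

/-- Over an irreducible locally noetherian scheme satisfying `S₂`, a section of a locally free
module over a nonempty open subset extends if it extends around the points of codimension at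
most `1`. -/
theorem exists_extension_of_coheight_le_one (k : Type u) [Field k]
    [Y.Over (Spec (CommRingCat.of k))] (hN : LocallyFree N) (hS : SerreCondition Y 2)
    {U W : Y.Opens} (hWU : W ≤ U) (hW : genericPoint Y ∈ W) (q : Γ(N, W))
    (h : ∀ x ∈ U, Order.coheight x ≤ 1 → ∃ (T : Y.Opens), T ≤ U ∧ x ∈ T ∧ ∃ m : Γ(N, T),
      resMod N (homOfLE inf_le_right : W ⊓ T ⟶ T) m =
        resMod N (homOfLE inf_le_left : W ⊓ T ⟶ W) q) :
    ∃ m : Γ(N, U), resMod N (homOfLE hWU) m = q := by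
  have hS1 : SerreCondition Y 1 := fun x d hd => hS x d (hd.trans one_le_two)
  refine exists_extension_of_forall_mem k hN hS1 hWU hW q fun x hx => ?_
  obtain ⟨S, hxS, r, e, he⟩ := hN x
  -- On an affine neighbourhood where the module is free, the problem splits into coordinates, and
  -- each coordinate is a function to which the Hartogs statement applies.
  obtain ⟨A, hA, hxA, hAU⟩ := exists_isAffineOpen_mem_and_subset (x := x) (U := U ⊓ S) ⟨hx, hxS⟩
  replace hAU : A ≤ U ⊓ S := hAU
  have hAS : A ≤ S := hAU.trans inf_le_right
  have hWA : W ⊓ A ≤ A := inf_le_right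
  have hηA : genericPoint Y ∈ A := genericPoint_mem hxA
  have hηWA : genericPoint Y ∈ W ⊓ A := ⟨hW, hηA⟩
  obtain ⟨c, hc⟩ := (he (W ⊓ A) (hWA.trans hAS)).2 (resMod N (homOfLE inf_le_left) q)
  have hext : ∀ i, ∃ f : Γ(Y, A), resAlg k (homOfLE hWA) f = c i := fun i => by
    obtain ⟨f, hf⟩ := exists_germ_eq_of_coheight_le_one hS hA hηA
      (Y.presheaf.germ (W ⊓ A) _ hηWA (c i)) fun y hy hy1 => by
        obtain ⟨T, hTU, hyT, m, hm⟩ := h y (hAU hy).1 hy1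
        have hTA : T ⊓ A ≤ S := inf_le_right.trans hAS
        obtain ⟨d, hd⟩ := (he (T ⊓ A) hTA).2 (resMod N (homOfLE inf_le_left) m)
        have hηTA : genericPoint Y ∈ T ⊓ A := ⟨genericPoint_mem hyT, hηA⟩
        have hηI : genericPoint Y ∈ W ⊓ (T ⊓ A) := ⟨hW, hηTA⟩
        have hle : W ⊓ (T ⊓ A) ≤ T ⊓ A := inf_le_right
        have hle' : W ⊓ (T ⊓ A) ≤ W ⊓ A := inf_le_inf_left _ inf_le_right
        have hle'' : W ⊓ (T ⊓ A) ≤ W ⊓ T := inf_le_inf_left _ inf_le_left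
        -- Coordinates in the basis `e` are unique, so those of the given extension `m` and of `q`
        -- agree where both are defined.
        have hdc : (fun i => resAlg k (homOfLE hle) (d i)) =
            fun i => resAlg k (homOfLE hle') (c i) := by
          refine (he _ (hle.trans hTA)).1 ?_
          have h1 := congrArg (resMod N (homOfLE hle)) hd
          have h2 := congrArg (resMod N (homOfLE hle')) hc
          have h3 := congrArg (resMod N (homOfLE hle'')) hm
          dsimp only at h1 h2
          rw [sum_smul_res (k := k), resMod_resMod _ _ (homOfLE (hle.trans inf_le_left))] at h1
          rw [sum_smul_res (k := k), resMod_resMod _ _ (homOfLE inf_le_left)] at h2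
          rw [resMod_resMod _ _ (homOfLE (hle.trans inf_le_left)),
            resMod_resMod _ _ (homOfLE inf_le_left)] at h3
          dsimp only
          rw [h1, h2, h3]
        refine ⟨T ⊓ A, ⟨hyT, hy⟩, hηTA, d i, ?_⟩
        rw [← TopCat.Presheaf.germ_res_apply Y.presheaf (homOfLE hle) _ hηI,
          ← TopCat.Presheaf.germ_res_apply Y.presheaf (homOfLE hle') _ hηI]
        exact congrArg (Y.presheaf.germ _ _ hηI) (congrFun hdc i)
    refine ⟨f, ?_⟩
    rw [← sub_eq_zero]
    refine eq_zero_of_germ_genericPoint hS1 hηWA ?_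
    rw [map_sub, sub_eq_zero, ← hf]
    exact TopCat.Presheaf.germ_res_apply Y.presheaf (homOfLE hWA) _ hηWA f
  choose f hf using hext
  refine ⟨A, hAU.trans inf_le_left, hxA, ∑ i, f i • resMod N (homOfLE hAS) (e i), ?_⟩
  rw [sum_smul_res (k := k), ← hc]
  simp only [hf]

end Modules

/-! ### Cokernels of sheafified maps and local preimages. -/

section Sheafify

variable {X : Scheme.{u}}

/-- Evaluation at an open set is exact on presheaves of modules, so the presheaf cokernel is
computed sectionwise. -/
theorem exists_preimage_of_cokernel_eq_zero {P Q : X.PresheafOfModules} (f : P ⟶ Q) (U : X.Opensᵒᵖ)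
    (q : Q.obj U) (hq : (Limits.cokernel.π f).app U q = 0) : ∃ p : P.obj U, f.app U p = q := by
  let S := ShortComplex.mk f (Limits.cokernel.π f) (Limits.cokernel.condition f)
  have hS : S.Exact := ShortComplex.exact_cokernel f
  have hE := hS.map (PresheafOfModules.evaluation _ U)
  rw [ShortComplex.moduleCat_exact_iff] at hE
  exact hE q hq

/-- The canonical map from a presheaf of modules to its sheafification. -/
def toSheafify (P : X.PresheafOfModules) :
    P ⟶ (Scheme.Modules.toPresheafOfModules X).obj (sheafify P) :=
  sheafifyEquiv P _ (𝟙 (sheafify P))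

theorem toSheafify_naturality {P Q : X.PresheafOfModules} (f : P ⟶ Q) (U : X.Opensᵒᵖ) (p : P.obj U) :
    ((PresheafOfModules.sheafification (𝟙 X.ringCatSheaf.obj)).map f).val.app U
      ((toSheafify P).app U p) = (toSheafify Q).app U (f.app U p) := by
  have := (PresheafOfModules.sheafificationAdjunction (𝟙 X.ringCatSheaf.obj)).unit.naturality f
  exact (congrArg (fun φ => φ.app U p) this).symm

/-- Two sections with the same image in the sheafification agree on a covering sieve; here the
second one is `0`. -/
theorem exists_res_eq_zero_of_toSheafify_eq_zero (P : X.PresheafOfModules) {U : X.Opens}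
    (p : P.obj (op U)) (hp : (toSheafify P).app (op U) p = 0) {x : X} (hx : x ∈ U) :
    ∃ (W : X.Opens) (i : W ⟶ U), x ∈ W ∧ P.map i.op p = 0 := by
  have := Presheaf.equalizerSieve_mem (Opens.grothendieckTopology X)
    (CategoryTheory.toSheafify (Opens.grothendieckTopology X) P.presheaf) (X := op U) p 0
      (hp.trans (map_zero ((toSheafify P).app (op U)).hom).symm)
  obtain ⟨W, i, hi, hxW⟩ := this x hx
  exact ⟨W, i, hxW, Eq.trans hi (map_zero (P.map i.op).hom)⟩

/-- The sheafified projection onto the presheaf cokernel kills the sheafified `f`, so it factors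
through the sheaf cokernel. There the class of `q` has zero germ at `x`, hence vanishes nearby. The
class of `q` in the presheaf cokernel then vanishes after a further shrinking, which yields a
preimage. -/
theorem exists_preimage_of_notMem_support {P Q : X.PresheafOfModules} (f : P ⟶ Q) {x : X}
    (hx : x ∉ support (Limits.cokernel
      ((PresheafOfModules.sheafification (𝟙 X.ringCatSheaf.obj)).map f) : X.Modules))
    {U : X.Opens} (hxU : x ∈ U) (q : Q.obj (op U)) :
    ∃ (W : X.Opens) (i : W ⟶ U), x ∈ W ∧ ∃ p : P.obj (op W), f.app (op W) p = Q.map i.op q := by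
  let S := PresheafOfModules.sheafification (𝟙 X.ringCatSheaf.obj)
  let F : sheafify P ⟶ sheafify Q := S.map f
  let G : sheafify Q ⟶ sheafify (Limits.cokernel f) := S.map (Limits.cokernel.π f)
  have hFG : F ≫ G = 0 := by
    have := Functor.preservesZeroMorphisms_of_isLeftAdjoint S
    change S.map f ≫ S.map _ = 0
    rw [← S.map_comp, Limits.cokernel.condition]
    exact S.map_zero _ _
  let g := Limits.cokernel.desc F G hFG
  have hg : Limits.cokernel.π F ≫ g = G := Limits.cokernel.π_desc _ _ _
  let s : Γ(Limits.cokernel F, U) := (Limits.cokernel.π F).app U ((toSheafify Q).app (op U) q)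
  have hs : (Limits.cokernel F).presheaf.germ U x hxU s =
      (Limits.cokernel F).presheaf.germ U x hxU 0 := by
    have : Subsingleton ((Limits.cokernel F).presheaf.stalk x) := not_nontrivial_iff_subsingleton.1 hx
    exact Subsingleton.elim _ _
  obtain ⟨W, hxW, i, j, hW⟩ := TopCat.Presheaf.germ_eq _ x hxU hxU _ _ hs
  have h0 : (toSheafify (Limits.cokernel f)).app (op W) ((Limits.cokernel.π f).app (op W) (Q.map i.op q)) = 0 := by
    refine (toSheafify_naturality (Limits.cokernel.π f) (op W) (Q.map i.op q)).symm.trans ?_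
    refine (congrArg (G.val.app (op W))
      (PresheafOfModules.naturality_apply (toSheafify Q) i.op q)).trans ?_
    have h1 : (Limits.cokernel.π F).app W ((sheafify Q).presheaf.map i.op
        ((toSheafify Q).app (op U) q)) = 0 := by
      refine Eq.trans ?_ (hW.trans ?_)
      · exact PresheafOfModules.naturality_apply (Limits.cokernel.π F).val i.op _
      · exact map_zero ((Limits.cokernel F).presheaf.map j.op).hom
    have h2 := congrArg (fun φ => φ.app W ((sheafify Q).presheaf.map i.op
        ((toSheafify Q).app (op U) q))) hg
    refine h2.symm.trans ?_
    exact (congrArg (g.app W) h1).trans (map_zero (g.app W).hom)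
  obtain ⟨W', i', hxW', h'⟩ := exists_res_eq_zero_of_toSheafify_eq_zero _ _ h0 hxW
  refine ⟨W', i' ≫ i, hxW', exists_preimage_of_cokernel_eq_zero f _ _ ?_⟩
  have h1 : Q.map (i' ≫ i).op q = Q.map i'.op (Q.map i.op q) :=
    congrArg (fun φ => φ.hom q) (Q.map_comp i.op i'.op)
  exact (congrArg ((Limits.cokernel.π f).app (op W')) h1).trans
    ((PresheafOfModules.naturality_apply (Limits.cokernel.π f) i'.op _).trans h')

end Sheafify

/-! ### Local surjectivity of the Taylor map. -/

section Taylor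

variable (k : Type u) [Field k] {X : Scheme.{u}} [X.Over (Spec (CommRingCat.of k))]

/-- Restriction of principal parts to a smaller open subset. -/
abbrev resParts (n : ℕ) (M : X.Modules) {U W : X.Opens} (h : W ≤ U) :
    PrincipalParts k Γ(X, U) Γ(M, U) n →ₛₗ[(resAlg k (homOfLE h) : Γ(X, U) →+* Γ(X, W))]
      PrincipalParts k Γ(X, W) Γ(M, W) n :=
  principalPartsMap k n (resAlg k (homOfLE h)) (resMod M (homOfLE h)) (resMod_smul k M _)

variable {V : Type u} [AddCommGroup V] [Module k V]

/-- The Taylor map is surjective at `x`: principal parts near `x` lie, after shrinking, in the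
image of the Taylor map. -/
def TaylorSurjectiveAt (n : ℕ) (M : X.Modules) (i : V →ₗ[k] Γ(M, ⊤)) (x : X) : Prop :=
  ∀ (U : X.Opens), x ∈ U → ∀ p : PrincipalParts k Γ(X, U) Γ(M, U) n,
    ∃ (W : X.Opens) (h : W ≤ U), x ∈ W ∧ ∃ t : Γ(X, W) ⊗[k] V,
      taylorApp k n M i W t = resParts k n M h p

theorem taylorSurjectiveAt_of_notMem_support {n : ℕ} {M : X.Modules} {i : V →ₗ[k] Γ(M, ⊤)} {x : X}
    (hx : x ∉ support (taylorCoker k n M i)) : TaylorSurjectiveAt k n M i x := by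
  intro U hxU p
  obtain ⟨W, j, hxW, t, ht⟩ :=
    exists_preimage_of_notMem_support (taylorPresheafMap k n M i) hx hxU p
  exact ⟨W, leOfHom j, hxW, t, ht⟩

end Taylor

/-! ### Transport of sections and principal parts along the open immersion. -/

section Extension

variable {k : Type u} [Field k] {X : Scheme.{u}} [X.Over (Spec (CommRingCat.of k))]
  {Y : Scheme.{u}} [Y.Over (Spec (CommRingCat.of k))]

theorem diffOp_ext {n : ℕ} {M : X.Modules} {P Q : DiffOp k n M}
    (h : ∀ U x, diffOpApp P U x = diffOpApp Q U x) : P = Q := by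
  apply (sheafifyEquiv _ _).injective
  ext U x
  exact h U.unop x

/-- The differential operator given by a compatible family of linear maps on principal parts. -/
def mkDiffOp {n : ℕ} {M : X.Modules}
    (f : ∀ U : X.Opens, PrincipalParts k Γ(X, U) Γ(M, U) n →ₗ[Γ(X, U)] Γ(M, U))
    (hf : ∀ {U W : X.Opens} (h : W ≤ U) (x), f W (resParts k n M h x) =
      resMod M (homOfLE h) (f U x)) : DiffOp k n M :=
  (sheafifyEquiv _ _).symm (PresheafOfModules.homMk
    { app := fun U => AddCommGrpCat.ofHom (f U.unop).toAddMonoidHom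
      naturality := fun U W g => by
        ext x
        exact hf (leOfHom g.unop) x }
    (fun U a x => (f U.unop).map_smul a x))

theorem diffOpApp_mkDiffOp {n : ℕ} {M : X.Modules}
    (f : ∀ U : X.Opens, PrincipalParts k Γ(X, U) Γ(M, U) n →ₗ[Γ(X, U)] Γ(M, U))
    (hf : ∀ {U W : X.Opens} (h : W ≤ U) (x), f W (resParts k n M h x) =
      resMod M (homOfLE h) (f U x)) (U : X.Opens) (x : PrincipalParts k Γ(X, U) Γ(M, U) n) :
    diffOpApp (mkDiffOp f hf) U x = f U x := by
  change ((sheafifyEquiv (principalPartsPresheaf k n M) M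
    ((sheafifyEquiv (principalPartsPresheaf k n M) M).symm _)).app (op U)).hom x = _
  rw [Equiv.apply_symm_apply]
  rfl

variable (j : X ⟶ Y) [IsOpenImmersion j] [j.IsOver (Spec (CommRingCat.of k))]
  {M : X.Modules} {N : Y.Modules} (ψ : N.restrict j ≅ M)

theorem imageMod_pullMod (W : X.Opens) (m : Γ(N, j ''ᵁ W)) :
    imageMod j ψ W (pullMod j ψ W m) = m :=
  congrArg (fun φ => φ.app W m) ψ.hom_inv_id

theorem pullMod_imageMod (W : X.Opens) (m : Γ(M, W)) :
    pullMod j ψ W (imageMod j ψ W m) = m :=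
  congrArg (fun φ => φ.app W m) ψ.inv_hom_id

variable (k) in
/-- Functions on an open subset of `Y`, restricted along `j`. -/
def openAlg {U : Y.Opens} {W : X.Opens} (h : j ''ᵁ W ≤ U) : Γ(Y, U) →ₐ[k] Γ(X, W) :=
  AlgHom.comp
    { __ := (j.appIso W).hom.hom
      commutes' := fun c => by
        rw [← appIso_scalars j W c]
        exact congrArg (fun φ => φ.hom (algebraMap k Γ(X, W) c)) (j.appIso W).inv_hom_id }
    (resAlg k (homOfLE h))

theorem imageAlg_openAlg {U : Y.Opens} {W : X.Opens} (h : j ''ᵁ W ≤ U) (a : Γ(Y, U)) :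
    imageAlg (k := k) j W (openAlg k j h a) = resAlg k (homOfLE h) a :=
  congrArg (fun φ => φ.hom (resAlg k (homOfLE h) a)) (j.appIso W).hom_inv_id

theorem imageAlg_injective (W : X.Opens) : Function.Injective (imageAlg (k := k) j W) :=
  Function.LeftInverse.injective (g := (j.appIso W).hom.hom) fun a =>
    congrArg (fun φ => φ.hom a) (j.appIso W).inv_hom_id

/-- Sections over an open subset of `Y`, restricted along `j`. -/
def openMod {U : Y.Opens} {W : X.Opens} (h : j ''ᵁ W ≤ U) : Γ(N, U) →+ Γ(M, W) :=
  (pullMod j ψ W).comp (resMod N (homOfLE h))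

theorem openMod_smul {U : Y.Opens} {W : X.Opens} (h : j ''ᵁ W ≤ U) (a : Γ(Y, U)) (m : Γ(N, U)) :
    openMod j ψ h (a • m) = openAlg k j h a • openMod j ψ h m := by
  change pullMod j ψ W (resMod N _ (a • m)) = _ • pullMod j ψ W _
  rw [resMod_smul k, ← pullMod_smul (k := k), imageAlg_openAlg]

theorem openMod_resMod {U U' : Y.Opens} {W : X.Opens} (hU : U' ≤ U) (h : j ''ᵁ W ≤ U')
    (m : Γ(N, U)) :
    openMod j ψ h (resMod N (homOfLE hU) m) = openMod j ψ (h.trans hU) m :=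
  congrArg (pullMod j ψ W) (resMod_resMod _ _ _ m)

theorem resMod_openMod {U : Y.Opens} {W W' : X.Opens} (hW : W' ≤ W) (h : j ''ᵁ W ≤ U)
    (m : Γ(N, U)) :
    resMod M (homOfLE hW) (openMod j ψ h m) =
      openMod j ψ ((j.image_mono hW).trans h) m := by
  refine (pullMod_res j ψ (homOfLE hW) _).symm.trans ?_
  exact congrArg (pullMod j ψ W') (resMod_resMod _ _ _ m)

theorem openAlg_resAlg {U U' : Y.Opens} {W : X.Opens} (hU : U' ≤ U) (h : j ''ᵁ W ≤ U')
    (a : Γ(Y, U)) :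
    openAlg k j h (resAlg k (homOfLE hU) a) = openAlg k j (h.trans hU) a := by
  apply imageAlg_injective (k := k) j
  rw [imageAlg_openAlg, imageAlg_openAlg, resAlg_resAlg]

theorem resAlg_openAlg {U : Y.Opens} {W W' : X.Opens} (hW : W' ≤ W) (h : j ''ᵁ W ≤ U)
    (a : Γ(Y, U)) :
    resAlg k (homOfLE hW) (openAlg k j h a) = openAlg k j ((j.image_mono hW).trans h) a := by
  apply imageAlg_injective (k := k) j
  rw [imageAlg_openAlg, imageAlg_res, imageAlg_openAlg]
  exact resAlg_resAlg _ _ _ a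

/-- Principal parts over an open subset of `Y`, restricted along `j`. -/
def openParts (n : ℕ) {U : Y.Opens} {W : X.Opens} (h : j ''ᵁ W ≤ U) :
    PrincipalParts k Γ(Y, U) Γ(N, U) n →ₛₗ[(openAlg k j h : Γ(Y, U) →+* Γ(X, W))]
      PrincipalParts k Γ(X, W) Γ(M, W) n :=
  principalPartsMap k n (openAlg k j h) (openMod j ψ h) (openMod_smul j ψ h)

theorem openParts_resParts (n : ℕ) {U U' : Y.Opens} {W : X.Opens} (hU : U' ≤ U)
    (h : j ''ᵁ W ≤ U') (p : PrincipalParts k Γ(Y, U) Γ(N, U) n) :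
    openParts j ψ n h (resParts k n N hU p) = openParts j ψ n (h.trans hU) p :=
  (principalPartsMap_comp k n _ _ _ _ _ _ _ _ _ (fun a => (openAlg_resAlg j hU h a).symm)
    (fun m => (openMod_resMod j ψ hU h m).symm) p).symm

theorem resParts_openParts (n : ℕ) {U : Y.Opens} {W W' : X.Opens} (hW : W' ≤ W)
    (h : j ''ᵁ W ≤ U) (p : PrincipalParts k Γ(Y, U) Γ(N, U) n) :
    resParts k n M hW (openParts j ψ n h p) =
      openParts j ψ n ((j.image_mono hW).trans h) p :=
  (principalPartsMap_comp k n _ _ _ _ _ _ _ _ _ (fun a => (resAlg_openAlg j hW h a).symm)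
    (fun m => (resMod_openMod j ψ hW h m).symm) p).symm

/-- Every principal part on `X` is a restriction from `Y`, so operators on `X` can be compared on
such restrictions alone. -/
theorem openParts_image (n : ℕ) (W : X.Opens) (x : PrincipalParts k Γ(X, W) Γ(M, W) n) :
    openParts j ψ n le_rfl
      (principalPartsMap k n (imageAlg j W) (imageMod j ψ W) (imageMod_smul j ψ W) x) = x := by
  induction x using principalParts_induction with
  | hadd x y hx hy => rw [map_add, map_add, hx, hy]
  | hmk a m =>
    rw [principalPartsMap_mk]
    refine (principalPartsMap_mk k n _ _ (openMod_smul (k := k) j ψ le_rfl) _ _).trans ?_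
    have h1 : openAlg k j le_rfl (imageAlg (k := k) j W a) = a := by
      apply imageAlg_injective (k := k) j
      rw [imageAlg_openAlg]
      exact resAlg_id k (op _) _
    have h2 : openMod j ψ le_rfl (imageMod j ψ W m) = m :=
      (congrArg (pullMod j ψ W) (resMod_self _ _)).trans (pullMod_imageMod j ψ W m)
    rw [h1, h2]

theorem diffOpApp_restrictOp {n : ℕ} (P : DiffOp k n N) (W : X.Opens)
    (x : PrincipalParts k Γ(X, W) Γ(M, W) n) :
    diffOpApp (restrictOp k j ψ n P) W x = restrictApp j ψ P W x := by
  change ((sheafifyEquiv _ _ ((sheafifyEquiv _ _).symm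
    (restrictPresheafMap j ψ P))).app (op W)).hom x = _
  rw [Equiv.apply_symm_apply]
  rfl

/-- The restricted operator is computed over `j ''ᵁ W`; naturality of `P` moves the computation up
to `U`. -/
theorem diffOpApp_restrictOp_openParts {n : ℕ} (P : DiffOp k n N) {U : Y.Opens} {W : X.Opens}
    (h : j ''ᵁ W ≤ U) (p : PrincipalParts k Γ(Y, U) Γ(N, U) n) :
    diffOpApp (restrictOp k j ψ n P) W (openParts j ψ n h p) =
      openMod j ψ h (diffOpApp P U p) := by
  rw [diffOpApp_restrictOp]
  change pullMod j ψ W (diffOpApp P _ (principalPartsMap k n _ _ _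
    (principalPartsMap k n _ _ _ p))) = pullMod j ψ W _
  rw [← diffOpApp_map, ← principalPartsMap_comp k n (openAlg k j h) (openMod j ψ h)
    (openMod_smul j ψ h) (imageAlg j W) (imageMod j ψ W) (imageMod_smul j ψ W)
    (resAlg k (homOfLE h)) (resMod N (homOfLE h)) (resMod_smul k N (homOfLE h))
    (fun a => (imageAlg_openAlg j h a).symm) (fun m => (imageMod_pullMod j ψ W _).symm)]

end Extension

/-! ### Extending the values of an operator from `X` to `Y`. -/

section Extension

variable {k : Type u} [Field k] {X : Scheme.{u}} [X.Over (Spec (CommRingCat.of k))]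
  {Y : Scheme.{u}} [Y.Over (Spec (CommRingCat.of k))]
  (j : X ⟶ Y) [IsOpenImmersion j] [j.IsOver (Spec (CommRingCat.of k))]
  {M : X.Modules} {N : Y.Modules} (ψ : N.restrict j ≅ M) {n : ℕ} (Q : DiffOp k n M)

/-- The section `m` of `N` over `U` restricts along `j` to the value of `Q` on the restriction of
the principal part `p`. -/
def IsValue {U : Y.Opens} (p : PrincipalParts k Γ(Y, U) Γ(N, U) n) (m : Γ(N, U)) : Prop :=
  ∀ (W : X.Opens) (h : j ''ᵁ W ≤ U),
    openMod j ψ h m = diffOpApp Q W (openParts j ψ n h p)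

variable {j ψ Q}

theorem IsValue.zero (U : Y.Opens) : IsValue j ψ Q (U := U) 0 0 := fun W h => by
  rw [map_zero, map_zero, map_zero]

theorem IsValue.add {U : Y.Opens} {p p' : PrincipalParts k Γ(Y, U) Γ(N, U) n} {m m' : Γ(N, U)}
    (h : IsValue j ψ Q p m) (h' : IsValue j ψ Q p' m') : IsValue j ψ Q (p + p') (m + m') :=
  fun W hW => by rw [map_add, map_add, map_add, h W hW, h' W hW]

theorem IsValue.smul {U : Y.Opens} (a : Γ(Y, U)) {p : PrincipalParts k Γ(Y, U) Γ(N, U) n}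
    {m : Γ(N, U)} (h : IsValue j ψ Q p m) : IsValue j ψ Q (a • p) (a • m) := fun W hW => by
  rw [openMod_smul (k := k), h W hW, LinearMap.map_smulₛₗ, LinearMap.map_smul]
  rfl

theorem IsValue.res {U U' : Y.Opens} (hU : U' ≤ U) {p : PrincipalParts k Γ(Y, U) Γ(N, U) n}
    {m : Γ(N, U)} (h : IsValue j ψ Q p m) :
    IsValue j ψ Q (resParts k n N hU p) (resMod N (homOfLE hU) m) := fun W hW => by
  rw [openMod_resMod, openParts_resParts, h]

variable {V : Type u} [AddCommGroup V] [Module k V] {i : V →ₗ[k] Γ(N, ⊤)}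

/-- If the values of `Q` on the sections in `V` extend to global sections, then the values of `Q`
on the image of the Taylor map extend. -/
theorem exists_isValue_taylorApp (hQ : ∀ v, ∃ w : Γ(N, ⊤),
      openMod j ψ (le_top : j ''ᵁ ⊤ ≤ ⊤) w =
        Q.act (openMod j ψ (le_top : j ''ᵁ ⊤ ≤ ⊤) (i v)))
    (U : Y.Opens) (t : Γ(Y, U) ⊗[k] V) : ∃ m, IsValue j ψ Q (taylorApp k n N i U t) m := by
  induction t with
  | zero => exact ⟨0, by rw [map_zero]; exact .zero U⟩
  | add x y hx hy =>
    obtain ⟨a, ha⟩ := hx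
    obtain ⟨b, hb⟩ := hy
    exact ⟨a + b, by rw [map_add]; exact ha.add hb⟩
  | tmul a v =>
    obtain ⟨w, hw⟩ := hQ v
    have h1 : IsValue j ψ Q (Submodule.Quotient.mk ((1 : Γ(Y, ⊤)) ⊗ₜ[k] i v)) w := by
      intro W h
      -- The restriction to `W` factors through all of `X`, where the value of `Q` is the
      -- restriction of the global section `w`.
      have h2 : openParts j ψ n h (Submodule.Quotient.mk ((1 : Γ(Y, ⊤)) ⊗ₜ[k] i v)) =
          resParts k n M le_top
            (Submodule.Quotient.mk ((1 : Γ(X, ⊤)) ⊗ₜ[k] openMod j ψ le_top (i v))) := by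
        rw [principalPartsMap_mk, resMod_openMod, map_one]
        refine (principalPartsMap_mk k n _ _ (openMod_smul (k := k) j ψ h) _ _).trans ?_
        rw [map_one]
      rw [h2, diffOpApp_map]
      refine (resMod_openMod j ψ (le_top : W ≤ ⊤) le_top w).symm.trans ?_
      rw [hw]
      rfl
    refine ⟨a • resMod N (homOfLE le_top) w, ?_⟩
    have h2 := (h1.res (le_top : U ≤ ⊤)).smul a
    rw [principalPartsMap_mk, map_one, ← Submodule.Quotient.mk_smul,
      TensorProduct.smul_tmul', smul_eq_mul, mul_one] at h2
    exact h2

/-- The image of `X` is a nonempty open set, so it contains the generic point of `Y`; an open `U`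
without that point is empty. -/
theorem openMod_injective (k : Type u) [Field k] [Y.Over (Spec (CommRingCat.of k))]
    [IrreducibleSpace X] [IrreducibleSpace Y] [IsLocallyNoetherian Y]
    (hN : LocallyFree N) (hS : SerreCondition Y 1) (U : Y.Opens) :
    Function.Injective (openMod j ψ (j.image_preimage_le U)) := by
  rw [injective_iff_map_eq_zero]
  intro m hm
  by_cases hU : genericPoint Y ∈ U
  · have hη : genericPoint Y ∈ j ''ᵁ (j ⁻¹ᵁ U) := by
      rw [Scheme.Hom.image_preimage_eq_opensRange_inf]
      exact ⟨genericPoint_mem (U := j.opensRange) ⟨genericPoint X, rfl⟩, hU⟩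
    apply resMod_injective k hN hS (j.image_preimage_le U) hη
    have := congrArg (imageMod j ψ _) hm
    rw [map_zero] at this ⊢
    rw [← this]
    exact (imageMod_pullMod j ψ _ _).symm
  · exact section_ext_of_locally fun x hx => (hU (genericPoint_mem hx)).elim

variable [IrreducibleSpace X] [IrreducibleSpace Y] [IsLocallyNoetherian Y]

/-- Uniqueness is what makes independently chosen values additive, linear and compatible with
restriction. -/
theorem IsValue.unique (hN : LocallyFree N) (hS : SerreCondition Y 1) {U : Y.Opens}
    {p : PrincipalParts k Γ(Y, U) Γ(N, U) n} {m m' : Γ(N, U)} (h : IsValue j ψ Q p m)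
    (h' : IsValue j ψ Q p m') : m = m' := by
  apply openMod_injective (j := j) (ψ := ψ) k hN hS U
  rw [h, h']

theorem restrictOp_injective (hN : LocallyFree N) (hS : SerreCondition Y 1) :
    Function.Injective (restrictOp k j ψ n) := by
  intro P P' h
  refine diffOp_ext fun U x => ?_
  apply openMod_injective (j := j) (ψ := ψ) k hN hS U
  rw [← diffOpApp_restrictOp_openParts, ← diffOpApp_restrictOp_openParts, h]

/-- An operator all of whose values extend is a restriction. -/
theorem exists_restrictOp_eq (hN : LocallyFree N) (hS : SerreCondition Y 1)
    (h : ∀ (U : Y.Opens) (p : PrincipalParts k Γ(Y, U) Γ(N, U) n), ∃ m, IsValue j ψ Q p m) :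
    ∃ P, restrictOp k j ψ n P = Q := by
  choose f hf using h
  refine ⟨mkDiffOp (fun U =>
    { toFun := f U
      map_add' := fun p p' => (hf U _).unique hN hS ((hf U p).add (hf U p'))
      map_smul' := fun a p => (hf U _).unique hN hS ((hf U p).smul a) })
    (fun h p => (hf _ _).unique hN hS ((hf _ p).res h)), diffOp_ext fun W x => ?_⟩
  rw [← openParts_image j ψ n W x, diffOpApp_restrictOp_openParts, diffOpApp_mkDiffOp]
  exact hf _ _ W le_rfl

/-- The values of `Q` extend if the Taylor map is surjective at enough points. -/
theorem exists_isValue (hN : LocallyFree N) (hS : SerreCondition Y 1)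
    (hQ : ∀ v, ∃ w : Γ(N, ⊤),
      openMod j ψ (le_top : j ''ᵁ ⊤ ≤ ⊤) w =
        Q.act (openMod j ψ (le_top : j ''ᵁ ⊤ ≤ ⊤) (i v)))
    (hT : (∀ x, TaylorSurjectiveAt k n N i x) ∨ SerreCondition Y 2 ∧
      ∀ x : Y, Order.coheight x ≤ 1 → TaylorSurjectiveAt k n N i x)
    (U : Y.Opens) (p : PrincipalParts k Γ(Y, U) Γ(N, U) n) : ∃ m, IsValue j ψ Q p m := by
  by_cases hU : genericPoint Y ∈ U
  swap
  · refine ⟨0, fun W h => section_ext_of_locally fun x hx => (hU ?_).elim⟩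
    exact genericPoint_mem (h ⟨x, hx, rfl⟩)
  have hle := j.image_preimage_le U
  have hη : genericPoint Y ∈ j ''ᵁ (j ⁻¹ᵁ U) := by
    rw [Scheme.Hom.image_preimage_eq_opensRange_inf]
    exact ⟨genericPoint_mem (U := j.opensRange) ⟨genericPoint X, rfl⟩, hU⟩
  -- The section to be extended to `U`: the value of `Q` on the restriction of `p`, carried to the
  -- image of `X` in `Y`.
  let q : Γ(N, j ''ᵁ (j ⁻¹ᵁ U)) :=
    imageMod j ψ _ (diffOpApp Q (j ⁻¹ᵁ U) (openParts j ψ n hle p))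
  have hq : IsValue j ψ Q (resParts k n N hle p) q := by
    intro W h
    have hW : W ≤ j ⁻¹ᵁ U := fun x hx => (h.trans hle) ⟨x, hx, rfl⟩
    rw [openParts_resParts, ← resParts_openParts j ψ n hW hle, diffOpApp_map]
    refine (resMod_openMod j ψ hW le_rfl q).symm.trans ?_
    refine congrArg (resMod M (homOfLE hW)) ?_
    exact (congrArg (pullMod j ψ _) (resMod_self _ q)).trans (pullMod_imageMod j ψ _ _)
  have hloc : ∀ x ∈ U, TaylorSurjectiveAt k n N i x → ∃ (T : Y.Opens), T ≤ U ∧ x ∈ T ∧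
      ∃ m : Γ(N, T), resMod N (homOfLE inf_le_right : j ''ᵁ (j ⁻¹ᵁ U) ⊓ T ⟶ T) m =
        resMod N (homOfLE inf_le_left : j ''ᵁ (j ⁻¹ᵁ U) ⊓ T ⟶ _) q := by
    intro x hx hTx
    obtain ⟨T, hTU, hxT, t, ht⟩ := hTx U hx p
    obtain ⟨m, hm⟩ := exists_isValue_taylorApp hQ T t
    -- On `T` the principal part `p` is a Taylor expansion, so `m` is a value of `Q` on `p`;
    -- uniqueness identifies it with `q` on the overlap.
    rw [ht] at hm
    refine ⟨T, hTU, hxT, m, ?_⟩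
    have h1 := hm.res (inf_le_right : j ''ᵁ (j ⁻¹ᵁ U) ⊓ T ≤ T)
    have h2 := hq.res (inf_le_left : j ''ᵁ (j ⁻¹ᵁ U) ⊓ T ≤ _)
    have h3 : resParts k n N (inf_le_right : j ''ᵁ (j ⁻¹ᵁ U) ⊓ T ≤ T) (resParts k n N hTU p) =
        resParts k n N (inf_le_left : j ''ᵁ (j ⁻¹ᵁ U) ⊓ T ≤ _) (resParts k n N hle p) := by
      rw [← principalPartsMap_comp k n _ _ _ _ _ _ (resAlg k (homOfLE (inf_le_right.trans hTU)))
        (resMod N (homOfLE (inf_le_right.trans hTU))) (resMod_smul k N _)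
        (fun a => (resAlg_resAlg _ _ _ a).symm) (fun m => (resMod_resMod _ _ _ m).symm),
        ← principalPartsMap_comp k n _ _ _ _ _ _ (resAlg k (homOfLE (inf_le_right.trans hTU)))
        (resMod N (homOfLE (inf_le_right.trans hTU))) (resMod_smul k N _)
        (fun a => (resAlg_resAlg _ _ _ a).symm) (fun m => (resMod_resMod _ _ _ m).symm)]
    rw [h3] at h1
    exact h1.unique hN hS h2
  obtain ⟨m, hm⟩ : ∃ m : Γ(N, U), resMod N (homOfLE hle) m = q := by
    obtain hT | ⟨hS2, hT⟩ := hT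
    · exact exists_extension_of_forall_mem k hN hS hle hη q fun x hx => hloc x hx (hT x)
    · exact exists_extension_of_coheight_le_one k hN hS2 hle hη q
        fun x hx hx1 => hloc x hx (hT x hx1)
  refine ⟨m, fun W h => ?_⟩
  have hW : j ''ᵁ W ≤ j ''ᵁ (j ⁻¹ᵁ U) := j.image_mono fun x hx => h ⟨x, hx, rfl⟩
  rw [← openMod_resMod j ψ hle hW, hm, hq, openParts_resParts]

end Extension

/-! ### First order jets: product and quotient rules. -/

section FirstOrder

variable (k : Type u) [CommRing k] {A : Type u} [CommRing A] [Algebra k A]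
  {M : Type u} [AddCommGroup M] [Module k M] [Module A M] [IsScalarTower k A M]

/-- The class of `1 ⊗ m` in the principal parts of order one. -/
def jet (m : M) : PrincipalParts k A M 1 := Submodule.Quotient.mk ((1 : A) ⊗ₜ[k] m)

theorem jet_add (m m' : M) : jet k (A := A) (m + m') = jet k m + jet k m' := by
  rw [jet, TensorProduct.tmul_add, Submodule.Quotient.mk_add]
  rfl

theorem jet_algebraMap_smul (c : k) (m : M) :
    jet k (algebraMap k A c • m) = algebraMap k A c • jet k (A := A) m := by
  rw [jet, jet, algebraMap_smul, algebraMap_smul, TensorProduct.tmul_smul]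
  rfl

/-- The product rule. -/
theorem jet_mul_smul (a b : A) (m : M) :
    jet k (A := A) ((a * b) • m) =
      a • jet k (b • m) + b • jet k (a • m) - (a * b) • jet k m := by
  rw [← sub_eq_zero]
  simp only [jet, ← Submodule.Quotient.mk_smul, ← Submodule.Quotient.mk_add,
    ← Submodule.Quotient.mk_sub, TensorProduct.smul_tmul', smul_eq_mul, mul_one]
  rw [Submodule.Quotient.mk_eq_zero]
  -- The four terms of the product rule are the expansion of a product of two elements of the
  -- diagonal ideal, which lies in `I ^ 2`; this is where order one matters.
  refine Submodule.subset_span ⟨((1 : A) ⊗ₜ[k] a - a ⊗ₜ[k] (1 : A)) *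
    ((1 : A) ⊗ₜ[k] b - b ⊗ₜ[k] (1 : A)), ?_, m, ?_⟩
  · rw [one_add_one_eq_two, pow_two]
    exact Ideal.mul_mem_mul (KaehlerDifferential.one_smul_sub_smul_one_mem_ideal k a)
      (KaehlerDifferential.one_smul_sub_smul_one_mem_ideal k b)
  · simp only [sub_mul, mul_sub, Algebra.TensorProduct.tmul_mul_tmul, one_mul, mul_one, map_sub]
    simp only [tensorAct, TensorProduct.AlgebraTensorModule.map_tmul, LinearMap.id_apply,
      LinearMap.coe_restrictScalars, LinearMap.toSpanSingleton_apply, one_smul]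
    abel

/-- The functions `a` such that the first order part of `a • e` lies in the submodule `N` form
a subalgebra. -/
def jetSubalgebra (e : M) (N : Submodule A (PrincipalParts k A M 1)) (he : jet k e ∈ N) :
    Subalgebra k A where
  carrier := {a | jet k (a • e) ∈ N}
  add_mem' {a b} ha hb := by
    change jet k ((a + b) • e) ∈ N
    rw [add_smul, jet_add]
    exact N.add_mem ha hb
  mul_mem' {a b} ha hb := by
    change jet k ((a * b) • e) ∈ N
    rw [jet_mul_smul]
    exact N.sub_mem (N.add_mem (N.smul_mem a hb) (N.smul_mem b ha)) (N.smul_mem _ he)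
  algebraMap_mem' c := by
    change jet k (algebraMap k A c • e) ∈ N
    rw [jet_algebraMap_smul]
    exact N.smul_mem _ he

/-- The quotient rule: the product rule for `b * r = a` expresses `b • jet k (r • e)` through
elements of `N`, and the unit `b` can be cancelled. -/
theorem jet_smul_mem_of_isUnit {e : M} {N : Submodule A (PrincipalParts k A M 1)}
    (he : jet k e ∈ N) {a b r : A} (hb : IsUnit b) (h : b * r = a)
    (ha : jet k (a • e) ∈ N) (hbN : jet k (b • e) ∈ N) : jet k (r • e) ∈ N := by
  have h1 : b • jet k (r • e) ∈ N := by
    have := jet_mul_smul k b r e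
    rw [h] at this
    rw [show b • jet k (r • e) = jet k (a • e) - r • jet k (b • e) + a • jet k e by
      rw [this]; abel]
    exact N.add_mem (N.sub_mem ha (N.smul_mem _ hbN)) (N.smul_mem _ he)
  obtain ⟨u, rfl⟩ := hb
  have := N.smul_mem (↑u⁻¹ : A) h1
  rwa [smul_smul, Units.inv_mul, one_smul] at this

end FirstOrder

/-! ### Coordinate rings of the standard charts of projective space. -/

section ProjectiveSpace

open HomogeneousLocalization

attribute [local instance] MvPolynomial.gradedAlgebra

variable (k : Type u) [Field k] (N : ℕ)

/-- The grading of the homogeneous coordinate ring of projective space. -/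
abbrev coordGrading : ℕ → Submodule k (MvPolynomial (Fin (N + 1)) k) :=
  MvPolynomial.homogeneousSubmodule (Fin (N + 1)) k

theorem adjoin_range_X :
    Algebra.adjoin (coordGrading k N 0) (Set.range (MvPolynomial.X : Fin (N + 1) → MvPolynomial _ k)) = ⊤ := by
  rw [← top_le_iff]
  intro p _
  induction p using MvPolynomial.induction_on with
  | C a => exact Subalgebra.algebraMap_mem _ (⟨_, MvPolynomial.isHomogeneous_C _ a⟩ : (coordGrading k N) 0)
  | add p q hp hq => exact Subalgebra.add_mem _ (hp trivial) (hq trivial)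
  | mul_X p i hp => exact Subalgebra.mul_mem _ (hp trivial) (Algebra.subset_adjoin ⟨i, rfl⟩)

theorem iSup_coordOpen : ⨆ i, coordOpen k N i = ⊤ :=
  Proj.iSup_basicOpen_eq_top' (coordGrading k N) _ (fun i => ⟨1, MvPolynomial.isHomogeneous_X k i⟩)
    (adjoin_range_X k N)

/-- The element `x_j / x_i` of the degree zero localization at `x_i`. -/
def awayRatio (i j : Fin (N + 1)) : Away (coordGrading k N) (MvPolynomial.X i) :=
  Away.mk _ (MvPolynomial.isHomogeneous_X k i) 1 (MvPolynomial.X j)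
    (by simpa using MvPolynomial.isHomogeneous_X k j)

theorem val_awayRatio (i j : Fin (N + 1)) :
    (awayRatio k N i j).val =
      Localization.mk (MvPolynomial.X j) ⟨MvPolynomial.X i, Submonoid.mem_powers _⟩ := by
  refine (Away.val_mk (coordGrading k N) 1 (MvPolynomial.isHomogeneous_X k i) _ _).trans ?_
  simp only [pow_one]

/-- The ring `k[x_0 / x_i, …, x_N / x_i]` is the degree zero localization at `x_i`. -/
theorem subring_away_eq_top (i : Fin (N + 1)) (T : Subring (Away (coordGrading k N) (MvPolynomial.X i)))
    (hC : ∀ c : k, fromZeroRingHom (coordGrading k N) _ (algebraMap k (coordGrading k N 0) c) ∈ T)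
    (hR : ∀ j, awayRatio k N i j ∈ T) : T = ⊤ := by
  rw [← top_le_iff]
  intro z _
  have hz : z ∈ (⊤ : Submodule (coordGrading k N 0) (Away (coordGrading k N) (MvPolynomial.X i))) := trivial
  rw [← Away.span_mk_prod_pow_eq_top (MvPolynomial.isHomogeneous_X k i)
    (MvPolynomial.X : Fin (N + 1) → MvPolynomial _ k) (adjoin_range_X k N) (fun _ => 1)
    (fun j => MvPolynomial.isHomogeneous_X k j)] at hz
  induction hz using Submodule.span_induction with
  | zero => exact T.zero_mem
  | add x y _ _ hx hy => exact T.add_mem (hx trivial) (hy trivial)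
  | smul a x _ hx =>
    rw [Algebra.smul_def]
    refine T.mul_mem ?_ (hx trivial)
    -- Homogeneous polynomials of degree zero are constants.
    obtain ⟨c, rfl⟩ : ∃ c : k, algebraMap k (coordGrading k N 0) c = a := by
      have h0 : a.1.totalDegree = 0 := Nat.le_zero.1 (MvPolynomial.IsHomogeneous.totalDegree_le a.2)
      exact ⟨_, Subtype.ext (MvPolynomial.totalDegree_eq_zero_iff_eq_C.1 h0).symm⟩
    exact hC c
  | mem x hx =>
    obtain ⟨a, ai, hai, rfl⟩ := hx
    -- A monomial of degree `a` over `x_i ^ a` is a product of ratios `x_j / x_i`; `hai` matches the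
    -- exponents in the denominator.
    have : Away.mk (coordGrading k N) (MvPolynomial.isHomogeneous_X k i) a (∏ j, MvPolynomial.X j ^ ai j)
        (hai ▸ SetLike.prod_pow_mem_graded _ _ _ _ fun j _ => MvPolynomial.isHomogeneous_X k j) =
        ∏ j, awayRatio k N i j ^ ai j := by
      apply val_injective
      refine (Away.val_mk (coordGrading k N) a (MvPolynomial.isHomogeneous_X k i) _ _).trans ?_
      rw [← HomogeneousLocalization.algebraMap_apply, map_prod]
      simp only [map_pow, HomogeneousLocalization.algebraMap_apply, val_awayRatio, Localization.mk_pow, Localization.mk_prod]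
      congr 1
      simp only [smul_eq_mul, mul_one] at hai
      ext1
      simp [← hai, Finset.prod_pow_eq_pow_sum]
    exact this ▸ T.prod_mem fun j _ => T.pow_mem (hR j) _

/-- Scalars on the right come from the structure morphism to `Spec k`, on the left from constants in
the graded ring. They agree because the structure morphism on the chart is induced by the ring map
`φ`, as seen on global sections. -/
theorem awayToSection_fromZero (i : Fin (N + 1)) (c : k) :
    Proj.awayToSection (coordGrading k N) (MvPolynomial.X i) (fromZeroRingHom (coordGrading k N) _ (algebraMap k (coordGrading k N 0) c)) =
      algebraMap k Γ(projSpace k N, coordOpen k N i) c := by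
  let U : (projSpace k N).Opens := coordOpen k N i
  let S := Spec (CommRingCat.of k)
  let φ : CommRingCat.of k ⟶ Γ(projSpace k N, U) :=
    CommRingCat.ofHom (algebraMap k (coordGrading k N 0)) ≫
      CommRingCat.ofHom (fromZeroRingHom (coordGrading k N) _) ≫
      Proj.awayToSection (coordGrading k N) (MvPolynomial.X i)
  have h1 : U.ι ≫ (projSpace k N ↘ S) = U.toSpecΓ ≫ Spec.map φ := by
    have hX : MvPolynomial.X i ∈ coordGrading k N 1 := MvPolynomial.isHomogeneous_X k i
    have h2 := Proj.awayι_toSpecZero (coordGrading k N) _ hX one_pos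
    rw [← Proj.basicOpenIsoSpec_inv_ι, Category.assoc, Iso.inv_comp_eq,
      Proj.basicOpenIsoSpec_hom, Proj.basicOpenToSpec, Category.assoc] at h2
    change U.ι ≫ Proj.toSpecZero _ ≫ _ = _
    refine (Category.assoc _ _ _).symm.trans ((congrArg (· ≫ Spec.map _) h2).trans ?_)
    have hφ : Spec.map φ = (Spec.map (Proj.awayToSection (coordGrading k N) (MvPolynomial.X i)) ≫
        Spec.map (CommRingCat.ofHom (fromZeroRingHom (coordGrading k N) _))) ≫
        Spec.map (CommRingCat.ofHom (algebraMap k (coordGrading k N 0))) :=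
      (Spec.map_comp _ _).trans (congrArg (· ≫ _) (Spec.map_comp _ _))
    rw [hφ]
    rfl
  have h3 := congrArg Scheme.Hom.appTop h1
  rw [Scheme.Hom.comp_appTop, Scheme.Hom.comp_appTop, Scheme.Opens.toSpecΓ_appTop,
    Scheme.ΓSpecIso_naturality_assoc] at h3
  have h4 : (Scheme.ΓSpecIso (CommRingCat.of k)).inv ≫ (projSpace k N ↘ S).appTop ≫
      U.ι.appTop ≫ U.topIso.hom = φ := by
    rw [reassoc_of% h3, Iso.inv_hom_id_assoc, Iso.inv_hom_id, Category.comp_id]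
  refine (congrArg (fun φ => φ.hom c) h4).symm.trans ?_
  have h5 : U.ι.appTop ≫ U.topIso.hom = (projSpace k N).presheaf.map (homOfLE le_top).op := by
    rw [Scheme.Opens.ι_appTop, Scheme.Opens.topIso_hom]
    exact ((projSpace k N).presheaf.map_comp _ _).symm
  rw [h5]
  rfl

theorem val_mapId_awayRatio (x : ProjectiveSpectrum (coordGrading k N)) {i : Fin (N + 1)}
    (hi : MvPolynomial.X i ∉ x.asHomogeneousIdeal) (j : Fin (N + 1)) :
    (mapId (coordGrading k N) (Submonoid.powers_le.mpr hi) (awayRatio k N i j) :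
      AtPrime (coordGrading k N) x.asHomogeneousIdeal.toIdeal).val =
      Localization.mk (MvPolynomial.X j) ⟨MvPolynomial.X i, hi⟩ := by
  have : (⟨MvPolynomial.X i ^ 1, by rwa [pow_one]⟩ : x.asHomogeneousIdeal.toIdeal.primeCompl) =
    ⟨MvPolynomial.X i, hi⟩ := Subtype.ext (pow_one _)
  rw [← this]
  rfl

theorem mapId_awayRatio_mul (x : ProjectiveSpectrum (coordGrading k N)) {i l : Fin (N + 1)}
    (hi : MvPolynomial.X i ∉ x.asHomogeneousIdeal) (hl : MvPolynomial.X l ∉ x.asHomogeneousIdeal)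
    (j : Fin (N + 1)) :
    (mapId (coordGrading k N) (Submonoid.powers_le.mpr hi) (awayRatio k N i l) :
      AtPrime (coordGrading k N) x.asHomogeneousIdeal.toIdeal) *
      mapId (coordGrading k N) (Submonoid.powers_le.mpr hl) (awayRatio k N l j) =
    mapId (coordGrading k N) (Submonoid.powers_le.mpr hi) (awayRatio k N i j) := by
  apply val_injective
  rw [val_mul, val_mapId_awayRatio k N x hi, val_mapId_awayRatio k N x hl,
    val_mapId_awayRatio k N x hi, Localization.mk_mul, Localization.mk_eq_mk_iff, Localization.r_iff_exists]
  exact ⟨1, by simp; ring⟩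

/-- Sections of the structure sheaf of `Proj` are functions with values in homogeneous
localizations, so the identity is checked pointwise on fractions. -/
theorem coordRatio_cocycle (i l j : Fin (N + 1)) :
    (projSpace k N).presheaf.map (homOfLE inf_le_left : coordOpen k N i ⊓ coordOpen k N l ⟶ _).op
        (coordRatio k N i l) *
      (projSpace k N).presheaf.map (homOfLE inf_le_right : coordOpen k N i ⊓ coordOpen k N l ⟶ _).op
        (coordRatio k N l j) =
    (projSpace k N).presheaf.map (homOfLE inf_le_left : coordOpen k N i ⊓ coordOpen k N l ⟶ _).op
        (coordRatio k N i j) := by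
  apply Subtype.ext
  funext ⟨x, hx⟩
  exact mapId_awayRatio_mul k N x hx.1 hx.2 j

end ProjectiveSpace

/-! ### Coordinates and local functions on a subscheme of projective space. -/

section VeryAmple

open HomogeneousLocalization

attribute [local instance] MvPolynomial.gradedAlgebra

variable {k : Type u} [Field k] {X : Scheme.{u}} [X.Over (Spec (CommRingCat.of k))]

theorem app_algebraMap {Y : Scheme.{u}} [Y.Over (Spec (CommRingCat.of k))] (f : X ⟶ Y)
    [f.IsOver (Spec (CommRingCat.of k))] (U : Y.Opens) (c : k) :
    f.app U (algebraMap k Γ(Y, U) c) = algebraMap k Γ(X, f ⁻¹ᵁ U) c := by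
  have hf : f ≫ (Y ↘ Spec (CommRingCat.of k)) = X ↘ Spec (CommRingCat.of k) :=
    comp_over f (Spec (CommRingCat.of k))
  have h : (Y ↘ Spec (CommRingCat.of k)).appTop ≫
      Y.presheaf.map (homOfLE le_top : U ⟶ ⊤).op ≫ f.app U =
      (X ↘ Spec (CommRingCat.of k)).appTop ≫
        X.presheaf.map (homOfLE le_top : f ⁻¹ᵁ U ⟶ ⊤).op := by
    rw [← hf, Scheme.Hom.comp_appTop, Category.assoc, f.naturality]
    rfl
  exact congrArg (fun φ => φ.hom ((Scheme.ΓSpecIso (CommRingCat.of k)).inv c)) h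

variable {N : ℕ} (f : X ⟶ projSpace k N)

variable (k) in
theorem resAlg_app {Y : Scheme.{u}} (f : X ⟶ Y) {U V : Y.Opens} (h : V ≤ U) {W : X.Opens}
    (hV : W ≤ f ⁻¹ᵁ V) (hU : W ≤ f ⁻¹ᵁ U) (a : Γ(Y, U)) :
    resAlg k (homOfLE hU) (f.app U a) =
      resAlg k (homOfLE hV) (f.app V (Y.presheaf.map (homOfLE h).op a)) := by
  have h1 := congrArg (fun φ => φ.hom a) (f.naturality (homOfLE h).op)
  refine Eq.trans ?_ (congrArg (resAlg k (homOfLE hV)) h1).symm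
  exact (resAlg_resAlg (homOfLE (f.preimage_mono h)) (homOfLE hV) (homOfLE hU) (f.app U a)).symm

/-- The homogeneous coordinates are global sections of the pullback of `O(1)`. -/
theorem exists_coordinate_sections {L : X.Modules} (e : ∀ i, Γ(L, f ⁻¹ᵁ coordOpen k N i))
    (he : ∀ (i j) (W : X.Opens) (hi : W ≤ f ⁻¹ᵁ coordOpen k N i) (hj : W ≤ f ⁻¹ᵁ coordOpen k N j),
      resMod L (homOfLE hj) (e j) =
        resAlg k (homOfLE hi) (f.app (coordOpen k N i) (coordRatio k N i j)) •
          resMod L (homOfLE hi) (e i)) (j : Fin (N + 1)) :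
    ∃ s : Γ(L, ⊤), ∀ i, resMod L (homOfLE le_top) s =
      f.app (coordOpen k N i) (coordRatio k N i j) • e i := by
  obtain ⟨s, hs, -⟩ := TopCat.Sheaf.existsUnique_gluing' ⟨L.presheaf, L.isSheaf⟩
    (fun i => f ⁻¹ᵁ coordOpen k N i) ⊤ (fun i => homOfLE le_top)
    (fun x _ => by
      have h : f x ∈ ⨆ i, coordOpen k N i := iSup_coordOpen k N ▸ Opens.mem_top _
      obtain ⟨i, hi⟩ := Opens.mem_iSup.1 h
      exact Opens.mem_iSup.2 ⟨i, hi⟩)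
    (fun i => f.app (coordOpen k N i) (coordRatio k N i j) • e i) fun i l => by
      let W : X.Opens := f ⁻¹ᵁ coordOpen k N i ⊓ f ⁻¹ᵁ coordOpen k N l
      have hi : W ≤ f ⁻¹ᵁ coordOpen k N i := inf_le_left
      have hl : W ≤ f ⁻¹ᵁ coordOpen k N l := inf_le_right
      have hW : W ≤ f ⁻¹ᵁ (coordOpen k N i ⊓ coordOpen k N l) := le_rfl
      change resMod L (homOfLE hi) _ = resMod L (homOfLE hl) _
      rw [resMod_smul k, resMod_smul k, he i l W hi hl, smul_smul]
      congr 1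
      rw [resAlg_app k f inf_le_left hW hi, resAlg_app k f inf_le_right hW hl,
        resAlg_app k f inf_le_left hW hi, ← coordRatio_cocycle k N i l j, map_mul, map_mul, mul_comm]
  exact ⟨s, hs⟩

/-- The restriction of `k[x_0 / x_i, …, x_N / x_i]` to an open subset of `X`. -/
def awayRes (i : Fin (N + 1)) {W : X.Opens} (hW : W ≤ f ⁻¹ᵁ coordOpen k N i) :
    Away (coordGrading k N) (MvPolynomial.X i) →+* Γ(X, W) :=
  (resAlg k (homOfLE hW)).toRingHom.comp ((f.app (coordOpen k N i)).hom.comp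
    (Proj.awayToSection (coordGrading k N) (MvPolynomial.X i)).hom)

theorem resAlg_awayRes (i : Fin (N + 1)) {W W' : X.Opens} (h : W' ≤ W)
    (hW : W ≤ f ⁻¹ᵁ coordOpen k N i) (z : Away (coordGrading k N) (MvPolynomial.X i)) :
    resAlg k (homOfLE h) (awayRes f i hW z) = awayRes f i (h.trans hW) z :=
  resAlg_resAlg _ _ _ _

theorem germ_awayRes (i : Fin (N + 1)) {W : X.Opens} (hW : W ≤ f ⁻¹ᵁ coordOpen k N i) {x : X}
    (hx : x ∈ W) (z : Away (coordGrading k N) (MvPolynomial.X i)) :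
    X.presheaf.germ W x hx (awayRes f i hW z) =
      f.stalkMap x ((projSpace k N).presheaf.germ (coordOpen k N i) (f x) (hW hx)
        (Proj.awayToSection (coordGrading k N) (MvPolynomial.X i) z)) := by
  refine Eq.trans ?_ (f.germ_stalkMap_apply (coordOpen k N i) x (hW hx) _).symm
  exact TopCat.Presheaf.germ_res_apply X.presheaf (homOfLE hW) x hx _

/-- An immersion is surjective on stalks, and the stalk of the affine chart is a localization of its
coordinate ring. So the germ of `r` is a quotient `a / b` of pulled back functions, and this
relation spreads to a neighbourhood. -/
theorem exists_awayRes_mul_eq [IsImmersion f] (i : Fin (N + 1)) {W : X.Opens}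
    (hW : W ≤ f ⁻¹ᵁ coordOpen k N i) (r : Γ(X, W)) {x : X} (hx : x ∈ W) :
    ∃ (W' : X.Opens) (h : W' ≤ W) (a b : Away (coordGrading k N) (MvPolynomial.X i)), x ∈ W' ∧
      IsUnit (awayRes f i (h.trans hW) b) ∧
      awayRes f i (h.trans hW) b * resAlg k (homOfLE h) r = awayRes f i (h.trans hW) a := by
  have hX : MvPolynomial.X i ∈ coordGrading k N 1 := MvPolynomial.isHomogeneous_X k i
  have hA : IsAffineOpen (coordOpen k N i) :=
    Proj.isAffineOpen_basicOpen (coordGrading k N) _ hX one_pos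
  have hsurj : Function.Surjective
      (Proj.awayToSection (coordGrading k N) (MvPolynomial.X i)).hom := fun b =>
    ⟨(Proj.basicOpenIsoAway (coordGrading k N) _ hX one_pos).inv b,
      congrArg (fun φ => φ.hom b) (Proj.basicOpenIsoAway (coordGrading k N) _ hX one_pos).inv_hom_id⟩
  have hfx : f x ∈ coordOpen k N i := hW hx
  obtain ⟨g, hg⟩ := f.stalkMap_surjective x (X.presheaf.germ W x hx r)
  let := TopCat.Presheaf.algebra_section_stalk (projSpace k N).presheaf
    (⟨f x, hfx⟩ : coordOpen k N i)
  have hloc := hA.isLocalization_stalk ⟨f x, hfx⟩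
  obtain ⟨⟨a, b⟩, hab⟩ := IsLocalization.surj (hA.primeIdealOf ⟨f x, hfx⟩).asIdeal.primeCompl g
  have hbu := IsLocalization.map_units ((projSpace k N).presheaf.stalk (f x)) b
  change g * (projSpace k N).presheaf.germ _ (f x) hfx b.1 =
    (projSpace k N).presheaf.germ _ (f x) hfx a at hab
  change IsUnit ((projSpace k N).presheaf.germ _ (f x) hfx b.1) at hbu
  obtain ⟨a', rfl⟩ := hsurj a
  obtain ⟨b, hb⟩ := b
  obtain ⟨b', rfl⟩ := hsurj b
  have h1 := congrArg (f.stalkMap x) hab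
  have hA' := germ_awayRes f i hW hx a'
  have hB' := germ_awayRes f i hW hx b'
  have h2 : IsUnit (X.presheaf.germ W x hx (awayRes f i hW b')) := by
    rw [hB']
    exact hbu.map (f.stalkMap x).hom
  have h3 : X.presheaf.germ W x hx (awayRes f i hW b' * r) =
      X.presheaf.germ W x hx (awayRes f i hW a') := by
    rw [map_mul, hA', hB', mul_comm, ← hg]
    exact (map_mul (f.stalkMap x).hom _ _).symm.trans h1
  obtain ⟨W₁, hx1, i1, i2, h4⟩ := TopCat.Presheaf.germ_eq _ x hx hx _ _ h3
  -- The relation holds on `W₁`; intersecting with the basic open set makes the denominator a unit.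
  have hle : W₁ ⊓ X.basicOpen (awayRes f i hW b') ≤ W := inf_le_left.trans (leOfHom i1)
  have hxm : x ∈ W₁ ⊓ X.basicOpen (awayRes f i hW b') :=
    ⟨hx1, (X.mem_basicOpen (awayRes f i hW b') x hx).2 h2⟩
  refine ⟨W₁ ⊓ X.basicOpen (awayRes f i hW b'), hle, a', b', hxm, ?_, ?_⟩
  · rw [← resAlg_awayRes f i (inf_le_right : W₁ ⊓ X.basicOpen (awayRes f i hW b') ≤ _)
      ((X.basicOpen_le _).trans hW), ← resAlg_awayRes f i (X.basicOpen_le _) hW]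
    exact (RingedSpace.isUnit_res_basicOpen _ (awayRes f i hW b')).map (resAlg k _)
  · rw [← resAlg_awayRes f i hle hW, ← resAlg_awayRes f i hle hW, ← map_mul]
    have h5 := congrArg (resAlg k (homOfLE (inf_le_left :
      W₁ ⊓ X.basicOpen (awayRes f i hW b') ≤ W₁))) h4
    exact (resAlg_resAlg i1 _ _ _).symm.trans (h5.trans (resAlg_resAlg i2 _ _ _))

end VeryAmple

/-! ### Surjectivity of the first order Taylor map. -/

section VeryAmple

open HomogeneousLocalization

attribute [local instance] MvPolynomial.gradedAlgebra

variable {k : Type u} [Field k] {X : Scheme.{u}} [X.Over (Spec (CommRingCat.of k))]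
  {V : Type u} [AddCommGroup V] [Module k V]

theorem taylorApp_res {n : ℕ} {M : X.Modules} {i : V →ₗ[k] Γ(M, ⊤)} {U W : X.Opens} (h : W ≤ U)
    (t : Γ(X, U) ⊗[k] V) :
    taylorApp k n M i W ((resAlg k (homOfLE h)).toLinearMap.rTensor V t) =
      resParts k n M h (taylorApp k n M i U t) :=
  PresheafOfModules.naturality_apply (taylorPresheafMap k n M i) (homOfLE h).op t

theorem resParts_resParts {n : ℕ} {M : X.Modules} {U U' W : X.Opens} (h : U' ≤ U) (h' : W ≤ U')
    (p : PrincipalParts k Γ(X, U) Γ(M, U) n) :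
    resParts k n M h' (resParts k n M h p) = resParts k n M (h'.trans h) p :=
  (principalPartsMap_comp k n _ _ _ _ _ _ _ _ _ (fun a => (resAlg_resAlg _ _ _ a).symm)
    (fun m => (resMod_resMod _ _ _ m).symm) p).symm

/-- The first order Taylor map of a very ample line bundle is surjective. -/
theorem taylorSurjectiveAt_of_isVeryAmple {L : X.Modules} (hL : IsVeryAmple k L)
    {i : V →ₗ[k] Γ(L, ⊤)} (hi : Function.Surjective i) (x : X) : TaylorSurjectiveAt k 1 L i x := by
  obtain ⟨N, f, hf, hf', e, he, he'⟩ := hL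
  intro U hxU p
  induction p using principalParts_induction with
  | hadd p q hp hq =>
    obtain ⟨W, h, hxW, t, ht⟩ := hp
    obtain ⟨W', h', hxW', t', ht'⟩ := hq
    have hx : x ∈ W ⊓ W' := ⟨hxW, hxW'⟩
    refine ⟨W ⊓ W', inf_le_left.trans h, hx,
      (resAlg k (homOfLE inf_le_left)).toLinearMap.rTensor V t +
        (resAlg k (homOfLE inf_le_right)).toLinearMap.rTensor V t', ?_⟩
    rw [map_add, taylorApp_res, taylorApp_res, ht, ht', resParts_resParts, resParts_resParts,
      map_add]
  | hmk a m =>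
    have hfx : f x ∈ ⨆ i, coordOpen k N i := iSup_coordOpen k N ▸ Opens.mem_top _
    obtain ⟨l, hl⟩ := Opens.mem_iSup.1 hfx
    have hxW : x ∈ U ⊓ f ⁻¹ᵁ coordOpen k N l := ⟨hxU, hl⟩
    have hW : U ⊓ f ⁻¹ᵁ coordOpen k N l ≤ f ⁻¹ᵁ coordOpen k N l := inf_le_right
    have hWU : U ⊓ f ⁻¹ᵁ coordOpen k N l ≤ U := inf_le_left
    obtain ⟨r, hr⟩ := (he l _ hW).2 (resMod L (homOfLE hWU) m)
    obtain ⟨W, h, c, b, hx, hb, hbc⟩ := exists_awayRes_mul_eq f l hW r hxW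
    have hWl := h.trans hW
    let e₀ : Γ(L, W) := resMod L (homOfLE hWl) (e l)
    let R := LinearMap.range (taylorApp k 1 L i W)
    -- Surjectivity of `i` enters here: the coordinates, being global sections, come from `V`.
    have hs : ∀ s : Γ(L, ⊤), jet k (A := Γ(X, W)) (resMod L (homOfLE le_top : W ⟶ ⊤) s) ∈ R := fun s => by
      obtain ⟨v, rfl⟩ := hi s
      exact ⟨1 ⊗ₜ v, rfl⟩
    have hR : ∀ j, jet k (A := Γ(X, W)) (awayRes f l hWl (awayRatio k N l j) • e₀) ∈ R := fun j => by
      obtain ⟨s, hsj⟩ := exists_coordinate_sections f e he' j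
      have h1 := congrArg (resMod L (homOfLE hWl)) (hsj l)
      rw [resMod_smul k, resMod_resMod _ _ (homOfLE le_top)] at h1
      exact (congrArg (jet k (A := Γ(X, W))) h1) ▸ hs s
    -- The generator is itself a coordinate: the transition relation with both indices `l` gives `e₀
    -- = (x_l / x_l) • e₀`.
    have he₀ : jet k (A := Γ(X, W)) e₀ ∈ R := (congrArg (jet k (A := Γ(X, W))) (he' l l W hWl hWl)) ▸ hR l
    let T := (jetSubalgebra k e₀ R he₀).toSubring.comap (awayRes f l hWl)
    have hT : T = ⊤ := by
      refine subring_away_eq_top k N l T (fun c => ?_) hR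
      have h1 : awayRes f l hWl (fromZeroRingHom (coordGrading k N) _
          (algebraMap k (coordGrading k N 0) c)) = algebraMap k Γ(X, W) c := by
        refine (congrArg (fun z => resAlg k (homOfLE hWl) (f.app (coordOpen k N l) z))
          (awayToSection_fromZero k N l c)).trans ?_
        rw [app_algebraMap, AlgHom.commutes]
      change awayRes f l hWl _ ∈ jetSubalgebra k e₀ R he₀
      rw [h1]
      exact Subalgebra.algebraMap_mem _ c
    have hT' : ∀ z, jet k (A := Γ(X, W)) (awayRes f l hWl z • e₀) ∈ R := fun z =>
      show z ∈ T from hT ▸ Subring.mem_top z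
    -- The coefficient `r` of `m` is the quotient `c / b` of chart functions on `W`, so the jet of
    -- `m` lies in the range.
    have h1 := jet_smul_mem_of_isUnit k he₀ hb hbc (hT' c) (hT' b)
    have h2 : resAlg k (homOfLE h) r • e₀ = resMod L (homOfLE (h.trans hWU)) m := by
      have h3 := congrArg (resMod L (homOfLE h)) hr
      rwa [resMod_resMod _ _ (homOfLE (h.trans hWU)), resMod_smul k,
        resMod_resMod _ _ (homOfLE hWl)] at h3
    rw [h2] at h1
    obtain ⟨t, ht⟩ := R.smul_mem (resAlg k (homOfLE (h.trans hWU)) a) h1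
    refine ⟨W, h.trans hWU, hx, t, ht.trans ?_⟩
    rw [principalPartsMap_mk, jet, ← Submodule.Quotient.mk_smul, TensorProduct.smul_tmul',
      smul_eq_mul, mul_one]

end VeryAmple

/-! ### Application to full completions. -/

section Main

variable {k : Type u} [Field k] {A B : LinearSystem k} (J : FullCompletion A B) {n : ℕ}

instance (A : LinearSystem k) : IsLocallyNoetherian A.X :=
  LocallyOfFiniteType.isLocallyNoetherian (A.X ↘ Spec (CommRingCat.of k))

theorem act_res {X : Scheme.{u}} [X.Over (Spec (CommRingCat.of k))] {M : X.Modules}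
    (P : DiffOp k n M) {U W : X.Opens} (h : W ≤ U) (m : Γ(M, U)) :
    P.act (resMod M (homOfLE h) m) = resMod M (homOfLE h) (P.act m) := by
  rw [DiffOp.act_eq, DiffOp.act_eq, ← diffOpApp_map, principalPartsMap_mk, map_one]

/-- An operator sends global sections to global sections, and by fullness these all come from `B.V`;
restriction along `J` carries this over to `A.V`. -/
theorem restrictOp_mem_preserving (P : DiffOp k n B.M) :
    restrictOp k J.j J.ψ n P ∈ preserving k n A.M A.i := by
  intro v
  obtain ⟨v, rfl⟩ := J.F.surjective v
  obtain ⟨w, hw⟩ := J.full.2 (P.act (B.i v))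
  refine ⟨J.F w, ?_⟩
  rw [restrictOp_act, J.compatible, J.compatible, imageMod_pullMod, act_res, hw]

/-- Preserving `A.V` is exactly what extends the values of `Q` on `A.V` to global sections: if `Q`
sends `J.F v` to `w`, then `J.F.symm w` gives the extension. -/
theorem exists_restrictOp_eq_of_mem_preserving (hB : SerreCondition B.X 1)
    (hT : (∀ x, TaylorSurjectiveAt k n B.M B.i x) ∨ SerreCondition B.X 2 ∧
      ∀ x : B.X, Order.coheight x ≤ 1 → TaylorSurjectiveAt k n B.M B.i x)
    {Q : DiffOp k n A.M} (hQ : Q ∈ preserving k n A.M A.i) :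
    ∃ P, restrictOp k J.j J.ψ n P = Q := by
  refine exists_restrictOp_eq B.locallyFree hB
    (exists_isValue B.locallyFree hB (fun v => ?_) hT)
  obtain ⟨w, hw⟩ := hQ (J.F v)
  refine ⟨B.i (J.F.symm w), ?_⟩
  have h1 := J.compatible v
  have h2 := J.compatible (J.F.symm w)
  rw [J.F.apply_symm_apply, ← hw, h1] at h2
  exact h2.symm

end Main

end DiffOps

end

theorem mainTheorem8 {k : Type u} [Field k] [CharZero k] (A B : DiffOps.LinearSystem k)
    (J : DiffOps.FullCompletion A B) (hB : DiffOps.SerreCondition B.X 1) (n : ℕ) :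
    ∃ r : DiffOps.DiffOp k n B.M →ₗ[k] DiffOps.preserving k n A.M A.i,
      (∀ P, (r P : DiffOps.DiffOp k n A.M) = DiffOps.restrictOp k J.j J.ψ n P) ∧
      Function.Injective r ∧
      (DiffOps.SerreCondition B.X 2 →
        2 ≤ DiffOps.codim (DiffOps.support (DiffOps.taylorCoker k n B.M B.i)) →
        Function.Bijective r) ∧
      (DiffOps.IsVeryAmple k B.M → n = 1 → Function.Bijective r) := by
  let r : DiffOps.DiffOp k n B.M →ₗ[k] DiffOps.preserving k n A.M A.i :=
    (DiffOps.restrictOp k J.j J.ψ n).codRestrict _ (DiffOps.restrictOp_mem_preserving J)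
  have hr : Function.Injective r := fun P Q h =>
    DiffOps.restrictOp_injective B.locallyFree hB (congrArg Subtype.val h)
  have hsurj : ((∀ x, DiffOps.TaylorSurjectiveAt k n B.M B.i x) ∨ DiffOps.SerreCondition B.X 2 ∧
      ∀ x : B.X, Order.coheight x ≤ 1 → DiffOps.TaylorSurjectiveAt k n B.M B.i x) →
      Function.Surjective r := fun hT Q => by
    obtain ⟨P, hP⟩ := DiffOps.exists_restrictOp_eq_of_mem_preserving J hB hT Q.2
    exact ⟨P, Subtype.ext hP⟩
  refine ⟨r, fun P => rfl, hr, fun hS hC => ⟨hr, hsurj (.inr ⟨hS, fun x hx => ?_⟩)⟩,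
    fun hL hn => ⟨hr, hsurj (.inl fun x => ?_)⟩⟩
  · refine DiffOps.taylorSurjectiveAt_of_notMem_support k fun hxs => ?_
    -- The codimension is an infimum of coheights, so a support point of coheight at most `1` would
    -- make it at most `1`.
    have h2 : (2 : ℕ∞) ≤ 1 := (hC.trans (iInf₂_le x hxs)).trans hx
    exact absurd h2 (by decide)
  · subst hn
    exact DiffOps.taylorSurjectiveAt_of_isVeryAmple hL J.full.2 x
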